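/- Let $K=\mathbb{Q}(\theta)$ be a number field, where $\theta$ is a root of an irreducible polynomial $F(x)=x^n+ax^m+b\in\mathbb{Z}[x]$ with $0<m<n$ (the case $a=0$ is allowed). Let $\mathbb{Z}_K$ be the ring of integers of $K$. The field $K$ is called monogenic if $\mathbb{Z}_K=\mathbb{Z}[\eta]$ for some $\eta\in\mathbb{Z}_K$, and its index is $i(K)=\gcd\{(\mathbb{Z}_K:\mathbb{Z}[\eta]) : \eta\in\mathbb{Z}_K,\ K=\mathbb{Q}(\eta)\}$. For a prime $p$, write $\nu_p$ for the $p$-adic valuation (with $\nu_p(0)=\infty$) and $\overline{t}$ for the image in $\mathbb{F}_p$ of a $p$-integral rational number $t$. For positive integers $d,s$, let $N_p(d)$ be the number of monic irreducible polynomials of degree $d$ in $\mathbb{F}_p[x]$; let $N_p(d,s,t)$ be the number of monic irreducible factors of degree $d$ of $x^s+\overline{t}$ in $\mathbb{F}_p[x]$ (counted without multiplicity); and let $N_p(d,s,t)[m,c]$ be the number of those factors which do not divide $x^m+\overline{c}$. Let $p$ be an odd prime such that $p\mid a$, $p\nmid b$ and $p\mid n$. Write $n=s\cdot p^r$ with $p\nmid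 s$, and let $\mu=\nu_p(a)$ and $\nu=\nu_p(b^{p-1}-1)$. Suppose that for some positive integer $d$ one of the following conditions holds: 1. $\mu<\min\{\nu,r+1\}$ and $N_p(d)<\mu\,N_p(d,s,b)$; 2. $\nu<\min\{\mu,r+1\}$ and $N_p(d)<\nu\,N_p(d,s,b)$; 3. $\mu=\nu\le r$ and $N_p(d)<\mu\,N_p(d,s,b)\left[m,\frac{b+(-b)^{p^r}}{a}\right]$ (here the rational number $\frac{b+(-b)^{p^r}}{a}$ has $p$-adic valuation $0$); 4. $r+1\le\min\{\nu,\mu\}$ and $N_p(d)<(r+1)\,N_p(d,s,b)$. Then $p$ divides $i(K)$; in particular, $K$ is not monogenic. -/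

import Mathlib

open Polynomial

/-- A number field `K` is monogenic if `𝓞 K = ℤ[η]` for some `η`. -/
def NumberField.IsMonogenicField (K : Type*) [Field K] [NumberField K] : Prop :=
  ∃ η : NumberField.RingOfIntegers K, Algebra.adjoin ℤ {η} = ⊤

/-- The index `(𝓞 K : ℤ[η])` of `ℤ[η]` in `𝓞 K`, as an index of additive groups. -/
noncomputable def NumberField.elementIndex {K : Type*} [Field K] [NumberField K]
    (η : NumberField.RingOfIntegers K) : ℕ :=
  (Subalgebra.toSubmodule (Algebra.adjoin ℤ {η})).toAddSubgroup.index

/-- The index `i(K)` of the field `K`: the greatest common divisor of the indices `(𝓞 K : ℤ[η])`,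
`η` running through the algebraic integers with `K = ℚ(η)`. The gcd of a set of integers is
the nonnegative generator of the ideal of `ℤ` that they span. -/
noncomputable def NumberField.fieldIndex (K : Type*) [Field K] [NumberField K] : ℕ :=
  (Submodule.IsPrincipal.generator (Ideal.span
    {z : ℤ | ∃ η : NumberField.RingOfIntegers K,
      IntermediateField.adjoin ℚ {(η : K)} = ⊤ ∧ z = NumberField.elementIndex η})).natAbs

/-- `fieldIndex` has the defining property of the gcd. -/
theorem NumberField.dvd_fieldIndex_iff (K : Type*) [Field K] [NumberField K] (d : ℕ) :
    d ∣ NumberField.fieldIndex K ↔ ∀ η : NumberField.RingOfIntegers K,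
      IntermediateField.adjoin ℚ {(η : K)} = ⊤ → d ∣ NumberField.elementIndex η := by
  unfold NumberField.fieldIndex
  rw [← Int.natCast_dvd, ← Ideal.span_singleton_le_span_singleton,
    Ideal.span_singleton_generator, Ideal.span_le]
  constructor
  · intro h η hη
    have := h ⟨η, hη, rfl⟩
    rw [SetLike.mem_coe, Ideal.mem_span_singleton] at this
    exact_mod_cast this
  · rintro h z ⟨η, hη, rfl⟩
    rw [SetLike.mem_coe, Ideal.mem_span_singleton]
    exact_mod_cast h η hη

/-- `N_p(d)`: the number of monic irreducible polynomials of degree `d` over `𝔽_p`. -/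
noncomputable def numIrred (p d : ℕ) : ℕ :=
  {g : (ZMod p)[X] | g.Monic ∧ Irreducible g ∧ g.natDegree = d}.ncard

/-- `N_p(d, s, t)`: the number of monic irreducible factors of degree `d` of `x ^ s + t`
over `𝔽_p`. -/
noncomputable def numIrredFactors (p d s : ℕ) (t : ZMod p) : ℕ :=
  {g : (ZMod p)[X] | g.Monic ∧ Irreducible g ∧ g.natDegree = d ∧ g ∣ X ^ s + C t}.ncard

/-- `N_p(d, s, t)[m, c]`: the number of monic irreducible factors of degree `d` of `x ^ s + t`
over `𝔽_p` which do not divide `x ^ m + c`. -/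
noncomputable def numIrredFactorsNotDvd (p d s : ℕ) (t : ZMod p) (m : ℕ) (c : ZMod p) : ℕ :=
  {g : (ZMod p)[X] | g.Monic ∧ Irreducible g ∧ g.natDegree = d ∧ g ∣ X ^ s + C t ∧
    ¬ g ∣ X ^ m + C c}.ncard

/-! The proof exhibits more primes of residue degree `d` above `p` than there are monic irreducible
polynomials of degree `d` over 𝔽_p. By Dedekind's argument this is impossible when `p` does not
divide the index of ℤ[η], so `p` divides every such index.

The primes come from Newton polygons over an algebraic closure of ℚ_p. Modulo `p` the trinomial F is
(x^s + b)^(p^r) up to a Frobenius twist, so F is expanded at the roots α of X^s + b. These are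
units, pairwise at distance 1, and F(α) = a α^m + (b + (-b)^(p^r)), where the bracket has valuation
ν. Each condition of the theorem yields an integer k such that F(α) has valuation k ≤ r, or
valuation at least k = r + 1. Since p^k divides `a`, the coefficients of F(x + α) are governed by
the binomials C(n, i), and the polygon has vertices (p^j, r - j) for r - j < k together with (0, k).
Thus it has k sides, each of height 1. If k = r + 1 the first vertex may lie higher, or at infinity,
but the last side has length 1, so the condition |x| ≤ 1/p picks out its single root.

Fix an irreducible factor φ and a side of length l. Height 1 forces l to divide the ramification
index e of any prime P met by the side (trivially if l = 1). At most deg φ of the roots α reduce to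
a root of φ, so at most l · deg φ embeddings lie on the side, and they include all e f embeddings
belonging to P. Hence f ≤ deg φ; the residue field contains a root of φ, so f = deg φ. Distinct
pairs (φ, side) give distinct primes, k for each φ.

The polygon is never drawn: roots of a given absolute value are counted through the first and last
maximal terms of a Gauss norm (`gauss_first_index`, `gauss_last_index`). The main links are
`HasPrimePowPolygon.countP_onSide`, `exists_local_data`, `exists_place_of_side` and
`ncard_primes_le_numIrred`. -/

open NumberField

/-! ### Gauss norms and the number of roots in a disc -/

section DominantIndex

variable {E : Type*} [NormedField E]

theorem coeff_X_sub_C_mul_zero (β : E) (f : E[X]) :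
    ((X - C β) * f).coeff 0 = 0 - β * f.coeff 0 := by
  simp [sub_mul, mul_coeff_zero]

theorem coeff_X_sub_C_mul_succ (β : E) (f : E[X]) (i : ℕ) :
    ((X - C β) * f).coeff (i + 1) = f.coeff i - β * f.coeff (i + 1) := by
  simp [sub_mul, coeff_X_mul]

theorem countP_norm_le_eq_add (ms : Multiset E) (c : ℝ) :
    ms.countP (‖·‖ ≤ c) = ms.countP (‖·‖ < c) + ms.countP (‖·‖ = c) := by
  induction ms using Multiset.induction_on with
  | empty => simp
  | cons β ms ih =>
    simp only [Multiset.countP_cons, ih]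
    rcases lt_trichotomy ‖β‖ c with h | h | h
    · simp [h.le, h, h.ne]; omega
    · simp [h]; omega
    · simp [h.not_ge, h.not_gt, h.ne']

variable [IsUltrametricDist E]

theorem norm_sub_le_max_of_ultrametric (x y : E) : ‖x - y‖ ≤ max ‖x‖ ‖y‖ := by
  simpa [sub_eq_add_neg] using IsUltrametricDist.norm_add_le_max x (-y)

theorem norm_sub_eq_right_of_lt {x y : E} (h : ‖x‖ < ‖y‖) : ‖x - y‖ = ‖y‖ := by
  have := IsUltrametricDist.norm_add_eq_max_of_norm_ne_norm (x := x) (y := -y) (by simpa using h.ne)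
  rw [sub_eq_add_neg, this, norm_neg, max_eq_right h.le]

theorem norm_sub_eq_left_of_lt {x y : E} (h : ‖y‖ < ‖x‖) : ‖x - y‖ = ‖x‖ := by
  rw [norm_sub_rev, norm_sub_eq_right_of_lt h]

/-- The last index at which the Gauss norm of radius `c` is attained is the number of roots
in the closed disc of radius `c`. -/
theorem gauss_last_index (ms : Multiset E) {c : ℝ} (hc : 0 < c) :
    (∀ i, ‖((ms.map fun β => X - C β).prod).coeff i‖ * c ^ i ≤
      ‖((ms.map fun β => X - C β).prod).coeff (ms.countP (‖·‖ ≤ c))‖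
        * c ^ (ms.countP (‖·‖ ≤ c))) ∧
    (∀ i, ms.countP (‖·‖ ≤ c) < i → ‖((ms.map fun β => X - C β).prod).coeff i‖ * c ^ i <
      ‖((ms.map fun β => X - C β).prod).coeff (ms.countP (‖·‖ ≤ c))‖
        * c ^ (ms.countP (‖·‖ ≤ c))) := by
  induction ms using Multiset.induction_on with
  | empty =>
    simp only [Multiset.map_zero, Multiset.prod_zero, Multiset.countP_zero, coeff_one]
    refine ⟨fun i => ?_, fun i hi => ?_⟩
    · rcases Nat.eq_zero_or_pos i with rfl | h <;> simp [*, Nat.ne_of_gt]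
    · simp [hi.ne']
  | cons β ms ih =>
    simp only [Multiset.map_cons, Multiset.prod_cons, Multiset.countP_cons]
    set f := (ms.map fun β => X - C β).prod
    set k := ms.countP (‖·‖ ≤ c)
    obtain ⟨h1, h2⟩ := ih
    set M := ‖f.coeff k‖ * c ^ k with hM
    have hM0 : 0 < M := lt_of_le_of_lt (by positivity) (h2 (k + 1) (Nat.lt_succ_self k))
    by_cases hβ : ‖β‖ ≤ c
    -- Multiplying by X - β scales the Gauss norm by max(c, |β|); the last maximal index moves up by
    -- one exactly when |β| ≤ c. For the first maximal index the condition is |β| < c.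
    · simp only [hβ, if_true]
      have hk : ‖((X - C β) * f).coeff (k + 1)‖ = ‖f.coeff k‖ := by
        rw [coeff_X_sub_C_mul_succ]
        apply norm_sub_eq_left_of_lt
        have := h2 (k + 1) (Nat.lt_succ_self k)
        rw [norm_mul]
        have h3 : ‖f.coeff (k + 1)‖ * c < ‖f.coeff k‖ := by
          have hck : 0 < c ^ k := by positivity
          rw [pow_succ] at this
          nlinarith
        nlinarith [norm_nonneg (f.coeff (k + 1))]
      have e : ‖((X - C β) * f).coeff (k + 1)‖ * c ^ (k + 1) = c * M := by
        rw [hk, hM]; ring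
      rw [e]
      have key : ∀ i, ‖((X - C β) * f).coeff (i + 1)‖ * c ^ (i + 1) ≤
          c * max (‖f.coeff i‖ * c ^ i) (‖f.coeff (i + 1)‖ * c ^ (i + 1)) := by
        intro i
        rw [coeff_X_sub_C_mul_succ]
        have hs := norm_sub_le_max_of_ultrametric (f.coeff i) (β * f.coeff (i + 1))
        have hn := norm_nonneg (f.coeff (i + 1))
        rcases le_max_iff.1 hs with h | h
        · calc _ ≤ ‖f.coeff i‖ * c ^ (i + 1) := by gcongr
            _ = c * (‖f.coeff i‖ * c ^ i) := by ring
            _ ≤ _ := by gcongr; exact le_max_left _ _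
        · rw [norm_mul] at h
          calc _ ≤ (‖β‖ * ‖f.coeff (i + 1)‖) * c ^ (i + 1) := by gcongr
            _ ≤ (c * ‖f.coeff (i + 1)‖) * c ^ (i + 1) := by gcongr
            _ = c * (‖f.coeff (i + 1)‖ * c ^ (i + 1)) := by ring
            _ ≤ _ := by gcongr; exact le_max_right _ _
      refine ⟨fun i => ?_, fun i hi => ?_⟩
      · cases i with
        | zero =>
          rw [coeff_X_sub_C_mul_zero, zero_sub, norm_neg, norm_mul, mul_assoc]
          have := h1 0
          gcongr
        | succ i => exact (key i).trans (by gcongr; exact max_le (h1 _) (h1 _))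
      · cases i with
        | zero => omega
        | succ i =>
          refine (key i).trans_lt ?_
          gcongr
          exact max_lt (h2 _ (by omega)) (h2 _ (by omega))
    · simp only [hβ, if_false, add_zero]
      push Not at hβ
      have key : ∀ i, ‖((X - C β) * f).coeff (i + 1)‖ * c ^ (i + 1) ≤
          max (c * (‖f.coeff i‖ * c ^ i)) (‖β‖ * (‖f.coeff (i + 1)‖ * c ^ (i + 1))) := by
        intro i
        rw [coeff_X_sub_C_mul_succ]
        have hs := norm_sub_le_max_of_ultrametric (f.coeff i) (β * f.coeff (i + 1))
        rcases le_max_iff.1 hs with h | h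
        · refine le_max_of_le_left ?_
          calc _ ≤ ‖f.coeff i‖ * c ^ (i + 1) := by gcongr
            _ = c * (‖f.coeff i‖ * c ^ i) := by ring
        · refine le_max_of_le_right ?_
          rw [norm_mul] at h
          calc _ ≤ (‖β‖ * ‖f.coeff (i + 1)‖) * c ^ (i + 1) := by gcongr
            _ = _ := by ring
      have e : ‖((X - C β) * f).coeff k‖ * c ^ k = ‖β‖ * M := by
        rcases hk : k with _ | j
        · rw [coeff_X_sub_C_mul_zero, zero_sub, norm_neg, norm_mul, hM, hk]; ring
        · rw [coeff_X_sub_C_mul_succ, norm_sub_eq_right_of_lt, norm_mul, hM, hk]; · ring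
          have := h1 j
          rw [hM, hk, pow_succ] at this
          have hcj : 0 < c ^ j := by positivity
          have h3 : ‖f.coeff j‖ ≤ c * ‖f.coeff (j + 1)‖ := by nlinarith
          have h4 : 0 < ‖f.coeff (j + 1)‖ := by
            rw [hM, hk] at hM0
            exact pos_of_mul_pos_left hM0 (by positivity)
          rw [norm_mul]; nlinarith
      rw [e]
      refine ⟨fun i => ?_, fun i hi => ?_⟩
      · cases i with
        | zero =>
          rw [coeff_X_sub_C_mul_zero, zero_sub, norm_neg, norm_mul, mul_assoc]
          have := h1 0
          gcongr
        | succ i =>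
          refine (key i).trans (max_le ?_ ?_)
          · exact mul_le_mul hβ.le (h1 _) (by positivity) (by positivity)
          · gcongr; exact h1 _
      · cases i with
        | zero => omega
        | succ i =>
          have hβ0 : 0 < ‖β‖ := hc.trans hβ
          refine (key i).trans_lt (max_lt ?_ ?_)
          · exact (mul_le_mul_of_nonneg_left (h1 i) hc.le).trans_lt
              (mul_lt_mul_of_pos_right hβ hM0)
          · exact mul_lt_mul_of_pos_left (h2 _ hi) hβ0

/-- The first index at which the Gauss norm of radius `c` is attained is the number of roots
in the open disc of radius `c`. -/
theorem gauss_first_index (ms : Multiset E) {c : ℝ} (hc : 0 < c) :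
    (∀ i, ‖((ms.map fun β => X - C β).prod).coeff i‖ * c ^ i ≤
      ‖((ms.map fun β => X - C β).prod).coeff (ms.countP (‖·‖ < c))‖
        * c ^ (ms.countP (‖·‖ < c))) ∧
    (∀ i, i < ms.countP (‖·‖ < c) → ‖((ms.map fun β => X - C β).prod).coeff i‖ * c ^ i <
      ‖((ms.map fun β => X - C β).prod).coeff (ms.countP (‖·‖ < c))‖
        * c ^ (ms.countP (‖·‖ < c))) ∧
    0 < ‖((ms.map fun β => X - C β).prod).coeff (ms.countP (‖·‖ < c))‖ := by
  induction ms using Multiset.induction_on with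
  | empty =>
    simp only [Multiset.map_zero, Multiset.prod_zero, Multiset.countP_zero, coeff_one]
    refine ⟨fun i => ?_, fun i hi => ?_, by simp⟩
    · rcases Nat.eq_zero_or_pos i with rfl | h <;> simp [*, Nat.ne_of_gt]
    · omega
  | cons β ms ih =>
    simp only [Multiset.map_cons, Multiset.prod_cons, Multiset.countP_cons]
    set f := (ms.map fun β => X - C β).prod
    set k := ms.countP (‖·‖ < c)
    obtain ⟨h1, h2, h0⟩ := ih
    set M := ‖f.coeff k‖ * c ^ k with hM
    have hM0 : 0 < M := by positivity
    have key : ∀ i, ‖((X - C β) * f).coeff (i + 1)‖ * c ^ (i + 1) ≤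
          max (c * (‖f.coeff i‖ * c ^ i)) (‖β‖ * (‖f.coeff (i + 1)‖ * c ^ (i + 1))) := by
      intro i
      rw [coeff_X_sub_C_mul_succ]
      have hs := norm_sub_le_max_of_ultrametric (f.coeff i) (β * f.coeff (i + 1))
      rcases le_max_iff.1 hs with h | h
      · refine le_max_of_le_left ?_
        calc _ ≤ ‖f.coeff i‖ * c ^ (i + 1) := by gcongr
          _ = c * (‖f.coeff i‖ * c ^ i) := by ring
      · refine le_max_of_le_right ?_
        rw [norm_mul] at h
        calc _ ≤ (‖β‖ * ‖f.coeff (i + 1)‖) * c ^ (i + 1) := by gcongr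
          _ = _ := by ring
    by_cases hβ : ‖β‖ < c
    · simp only [hβ, if_true]
      have hk : ‖((X - C β) * f).coeff (k + 1)‖ = ‖f.coeff k‖ := by
        rw [coeff_X_sub_C_mul_succ]
        apply norm_sub_eq_left_of_lt
        have := h1 (k + 1)
        rw [norm_mul]
        have h3 : ‖f.coeff (k + 1)‖ * c ≤ ‖f.coeff k‖ := by
          have hck : 0 < c ^ k := by positivity
          rw [pow_succ] at this
          nlinarith
        rcases (norm_nonneg (f.coeff (k + 1))).eq_or_lt with h | h
        · rw [← h, mul_zero]; exact h0
        · nlinarith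
      have e : ‖((X - C β) * f).coeff (k + 1)‖ * c ^ (k + 1) = c * M := by
        rw [hk, hM]; ring
      rw [e, hk]
      refine ⟨fun i => ?_, fun i hi => ?_, h0⟩
      · cases i with
        | zero =>
          rw [coeff_X_sub_C_mul_zero, zero_sub, norm_neg, norm_mul, mul_assoc]
          have := h1 0
          gcongr
        | succ i =>
          refine (key i).trans (max_le ?_ ?_)
          · gcongr; exact h1 _
          · exact mul_le_mul hβ.le (h1 _) (by positivity) (by positivity)
      · cases i with
        | zero =>
          rw [coeff_X_sub_C_mul_zero, zero_sub, norm_neg, norm_mul, mul_assoc]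
          exact (mul_le_mul_of_nonneg_left (h1 0) (norm_nonneg β)).trans_lt
              (mul_lt_mul_of_pos_right hβ hM0)
        | succ i =>
          refine (key i).trans_lt (max_lt ?_ ?_)
          · exact mul_lt_mul_of_pos_left (h2 i (by omega)) hc
          · exact (mul_le_mul_of_nonneg_left (h1 _) (norm_nonneg β)).trans_lt
              (mul_lt_mul_of_pos_right hβ hM0)
    · simp only [hβ, if_false, add_zero]
      push Not at hβ
      have hβ0 : 0 < ‖β‖ := hc.trans_le hβ
      have e' : ‖((X - C β) * f).coeff k‖ = ‖β‖ * ‖f.coeff k‖ := by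
        rcases hk : k with _ | j
        · rw [coeff_X_sub_C_mul_zero, zero_sub, norm_neg, norm_mul]
        · rw [coeff_X_sub_C_mul_succ, norm_sub_eq_right_of_lt, norm_mul]
          have := h2 j (by omega)
          rw [hM, hk, pow_succ] at this
          have hcj : 0 < c ^ j := by positivity
          have h3 : ‖f.coeff j‖ < c * ‖f.coeff (j + 1)‖ := by nlinarith
          rw [norm_mul]; nlinarith [norm_nonneg (f.coeff (j + 1))]
      have e : ‖((X - C β) * f).coeff k‖ * c ^ k = ‖β‖ * M := by
        rw [e', hM]; ring
      rw [e, e']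
      refine ⟨fun i => ?_, fun i hi => ?_, by positivity⟩
      · cases i with
        | zero =>
          rw [coeff_X_sub_C_mul_zero, zero_sub, norm_neg, norm_mul, mul_assoc]
          have := h1 0
          gcongr
        | succ i =>
          refine (key i).trans (max_le ?_ ?_)
          · exact mul_le_mul hβ (h1 _) (by positivity) (by positivity)
          · gcongr; exact h1 _
      · cases i with
        | zero =>
          rw [coeff_X_sub_C_mul_zero, zero_sub, norm_neg, norm_mul, mul_assoc]
          exact mul_lt_mul_of_pos_left (h2 _ hi) hβ0
        | succ i =>
          refine (key i).trans_lt (max_lt ?_ ?_)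
          · exact (mul_lt_mul_of_pos_left (h2 i (by omega)) hc).trans_le
              (mul_le_mul_of_nonneg_right hβ hM0.le)
          · exact mul_lt_mul_of_pos_left (h2 _ hi) hβ0

theorem countP_norm_le_eq (ms : Multiset E) {f : E[X]} (hf : f = (ms.map fun β => X - C β).prod)
    {c : ℝ} (hc : 0 < c) (N : ℕ)
    (hle : ∀ i < N, ‖f.coeff i‖ * c ^ i ≤ ‖f.coeff N‖ * c ^ N)
    (hlt : ∀ i, N < i → ‖f.coeff i‖ * c ^ i < ‖f.coeff N‖ * c ^ N) :
    ms.countP (‖·‖ ≤ c) = N := by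
  obtain ⟨h1, h2⟩ := gauss_last_index ms hc
  rw [← hf] at h1 h2
  rcases lt_trichotomy (ms.countP (‖·‖ ≤ c)) N with h | h | h
  · exact absurd (h2 _ h) (hle _ h).not_gt
  · exact h
  · exact absurd (hlt _ h) (h1 _).not_gt

theorem countP_norm_lt_eq (ms : Multiset E) {f : E[X]} (hf : f = (ms.map fun β => X - C β).prod)
    {c : ℝ} (hc : 0 < c) (N : ℕ)
    (hle : ∀ i, N < i → ‖f.coeff i‖ * c ^ i ≤ ‖f.coeff N‖ * c ^ N)
    (hlt : ∀ i < N, ‖f.coeff i‖ * c ^ i < ‖f.coeff N‖ * c ^ N) :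
    ms.countP (‖·‖ < c) = N := by
  obtain ⟨h1, h2, -⟩ := gauss_first_index ms hc
  rw [← hf] at h1 h2
  rcases lt_trichotomy (ms.countP (‖·‖ < c)) N with h | h | h
  · exact absurd (hlt _ h) (h1 _).not_gt
  · exact h
  · exact absurd (h2 _ h) (hle _ h).not_gt

end DominantIndex

/-! ### Valuations of binomial coefficients -/

/-- In i · C(n, i) = n · C(n - 1, i - 1) the right side is divisible by p^r, and i absorbs at most
p^u because i < p^(u+1). -/
theorem pow_dvd_choose_mul_pow {p s r u w i : ℕ} (hp : p.Prime) (hi : 1 ≤ i)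
    (hiu : i < p ^ (u + 1)) (hwu : w + u ≤ r) : p ^ w ∣ (s * p ^ r).choose i := by
  obtain ⟨j, rfl⟩ : ∃ j, i = j + 1 := ⟨i - 1, by omega⟩
  obtain ⟨v, q, hq, hv⟩ := Nat.exists_eq_pow_mul_and_not_dvd (n := j + 1) (by omega) p hp.ne_one
  have hvu : v ≤ u := by
    by_contra! h
    have : p ^ (u + 1) ≤ j + 1 := by
      rw [hv]
      exact (Nat.pow_le_pow_right hp.pos h).trans
        (Nat.le_mul_of_pos_right _ (Nat.pos_of_ne_zero (by rintro rfl; simp at hq)))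
    omega
  rcases hN : s * p ^ r with _ | N
  · simp
  · have h := Nat.add_one_mul_choose_eq N j
    rw [← hN, hv] at h
    have h1 : p ^ (v + w) ∣ (s * p ^ r).choose (p ^ v * q) * (p ^ v * q) := by
      rw [← h]
      exact Dvd.dvd.mul_right (Dvd.dvd.mul_left (pow_dvd_pow p (by omega)) s) _
    rw [show (s * p ^ r).choose (p ^ v * q) * (p ^ v * q) =
      p ^ v * ((s * p ^ r).choose (p ^ v * q) * q) by ring, pow_add] at h1
    have h2 := Nat.dvd_of_mul_dvd_mul_left (pow_pos hp.pos v) h1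
    rw [← hN, hv]
    exact ((Nat.Prime.coprime_iff_not_dvd hp).2 hq).pow_left w |>.dvd_of_dvd_mul_right h2

/-- The ratio C(N, i + 1) / C(N, i) is (N - i) / (i + 1), and N - i ≡ -(i + 1) modulo p^j. For i + 1
< p^j both have the same valuation, so the ratio is a unit at p. -/
theorem not_dvd_choose_pred {p N j : ℕ} (hp : p.Prime) (hN : p ^ j ∣ N + 1) {i : ℕ}
    (hi : i < p ^ j) : ¬ p ∣ N.choose i := by
  induction i with
  | zero => simpa using hp.ne_one
  | succ i ih =>
    have ih := ih (by omega)
    have hle : p ^ j ≤ N + 1 := Nat.le_of_dvd (by omega) hN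
    have h := Nat.choose_succ_right_eq N i
    obtain ⟨v, q, hq, hv⟩ := Nat.exists_eq_pow_mul_and_not_dvd (n := i + 1) (by omega) p hp.ne_one
    have hvj : v < j := by
      by_contra! hc
      have : p ^ j ≤ i + 1 := by
        rw [hv]
        exact (Nat.pow_le_pow_right hp.pos hc).trans
          (Nat.le_mul_of_pos_right _ (Nat.pos_of_ne_zero (by rintro rfl; simp at hq)))
      omega
    obtain ⟨M, hM⟩ := hN
    have e : N - i = p ^ v * (p ^ (j - v) * M - q) := by
      rw [Nat.mul_sub, ← mul_assoc, ← pow_add, ← hv, show v + (j - v) = j by omega, ← hM]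
      omega
    rw [e, hv] at h
    intro hd
    rw [hv] at hd
    have h' : N.choose (p ^ v * q) * q = N.choose i * (p ^ (j - v) * M - q) := by
      apply Nat.eq_of_mul_eq_mul_left (pow_pos hp.pos v)
      linarith
    have h3 : p ∣ N.choose i * (p ^ (j - v) * M - q) := h' ▸ hd.mul_right q
    rcases hp.dvd_mul.1 h3 with h4 | h4
    · exact ih h4
    · have h5 : p ∣ p ^ (j - v) * M := (dvd_pow_self p (by omega)).mul_right M
      have h6 : q ≤ p ^ (j - v) * M := by
        by_contra! hlt
        have : N - i = 0 := by rw [e, Nat.sub_eq_zero_of_le hlt.le, mul_zero]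
        omega
      exact hq ((Nat.dvd_sub_iff_right h6 h5).1 h4)

/-- The identity p^j · C(n, p^j) = n · C(n - 1, p^j - 1) gives the exact valuation, since the last
binomial is prime to p. These are the vertices of the polygon. -/
theorem choose_mul_pow_prime_pow {p s r j : ℕ} (hp : p.Prime) (hs : ¬ p ∣ s) (hj : j ≤ r) :
    ∃ q, ¬ p ∣ q ∧ (s * p ^ r).choose (p ^ j) = p ^ (r - j) * q := by
  have hs0 : s ≠ 0 := by rintro rfl; simp at hs
  obtain ⟨N, hN⟩ : ∃ N, s * p ^ r = N + 1 :=
    ⟨s * p ^ r - 1, by have : 0 < s * p ^ r := Nat.mul_pos (by omega) (pow_pos hp.pos r); omega⟩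
  obtain ⟨i, hi⟩ : ∃ i, p ^ j = i + 1 := ⟨p ^ j - 1, by have := pow_pos hp.pos j; omega⟩
  have h := Nat.add_one_mul_choose_eq N i
  refine ⟨s * N.choose i, ?_, ?_⟩
  · intro hd
    rcases hp.dvd_mul.1 hd with h1 | h1
    · exact hs h1
    · exact not_dvd_choose_pred hp (hN ▸ (pow_dvd_pow p hj).mul_left s) (by omega) h1
  · rw [← hN, ← hi] at h
    apply Nat.eq_of_mul_eq_mul_right (pow_pos hp.pos j)
    rw [← h]
    conv_lhs => rw [show r = (r - j) + j by omega, pow_add]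
    ring

/-- Bernoulli's inequality, with its strict form: this is the convexity of the chain of points (p^j,
r - j). -/
theorem succ_mul_le_pow {p : ℕ} (hp : 3 ≤ p) (v : ℕ) :
    (v + 1) * (p - 1) + 1 ≤ p ^ (v + 1) ∧ (1 ≤ v → (v + 1) * (p - 1) + 1 < p ^ (v + 1)) := by
  obtain ⟨q, rfl⟩ : ∃ q, p = q + 1 := ⟨p - 1, by omega⟩
  simp only [Nat.add_sub_cancel]
  have key : ∀ v, (v + 1) * q + 1 ≤ (q + 1) ^ (v + 1) := by
    intro v
    induction v with
    | zero => simp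
    | succ v ih =>
      rw [pow_succ]
      calc (v + 1 + 1) * q + 1 ≤ ((v + 1) * q + 1) * (q + 1) := by
            have := Nat.zero_le ((v + 1) * q * q)
            linarith [show ((v + 1) * q + 1) * (q + 1) =
              (v + 1 + 1) * q + 1 + (v + 1) * q * q by ring]
        _ ≤ _ := Nat.mul_le_mul_right _ ih
  refine ⟨key v, fun hv => ?_⟩
  obtain ⟨w, rfl⟩ : ∃ w, v = w + 1 := ⟨v - 1, by omega⟩
  rw [pow_succ]
  refine lt_of_lt_of_le ?_ (Nat.mul_le_mul_right _ (key w))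
  have hq : 0 < q := by omega
  have : 0 < (w + 1) * q * q := by positivity
  linarith [show ((w + 1) * q + 1) * (q + 1) =
    (w + 1 + 1) * q + 1 + (w + 1) * q * q by ring]

/-! ### Newton polygons with vertices at prime powers -/

section Sides

variable {E : Type*} [NormedField E]

/-- The lower bounds and exact values of the `p`-adic valuations of the coefficients of a
polynomial whose Newton polygon has the vertices `(0, k)` and `(p ^ j, r - j)`, `r - j < k`.
For `k = r + 1` the first vertex may lie higher. -/
structure HasPrimePowPolygon (p r k : ℕ) (f : E[X]) : Prop where
  norm_le_one : ∀ i, ‖f.coeff i‖ ≤ 1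
  norm_le : ∀ i u w, 1 ≤ i → i < p ^ (u + 1) → w + u ≤ r → w ≤ k →
    ‖f.coeff i‖ ≤ ((p : ℝ)⁻¹) ^ w
  norm_eq : ∀ j ≤ r, r - j < k → ‖f.coeff (p ^ j)‖ = ((p : ℝ)⁻¹) ^ (r - j)
  norm_zero_le : ‖f.coeff 0‖ ≤ ((p : ℝ)⁻¹) ^ k
  norm_zero_eq : k ≤ r → ‖f.coeff 0‖ = ((p : ℝ)⁻¹) ^ k

/-- The length of the `t`-th side, `1 ≤ t ≤ k`, counted from the right, of the polygon of
`HasPrimePowPolygon`. -/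
def sideLength (p r k t : ℕ) : ℕ := if t < k then p ^ (r - t) * (p - 1) else p ^ (r + 1 - k)

/-- The condition that a root with absolute value `x` belongs to the `t`-th side. -/
def OnSide (p r k t : ℕ) (x : ℝ) : Prop :=
  if t = r + 1 then x ≤ (p : ℝ)⁻¹ else x ^ sideLength p r k t = (p : ℝ)⁻¹

/-- The best choice in the family of bounds is u = ⌊log_p i⌋. -/
theorem HasPrimePowPolygon.norm_le_log {p r k : ℕ} {f : E[X]} (h : HasPrimePowPolygon p r k f)
    (hp : 1 < p) {i : ℕ} (hi : 1 ≤ i) :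
    ‖f.coeff i‖ ≤ ((p : ℝ)⁻¹) ^ (min (r - Nat.log p i) k) := by
  by_cases hr : Nat.log p i ≤ r
  · exact h.norm_le i (Nat.log p i) _ hi (Nat.lt_pow_succ_log_self hp i) (by omega) (by omega)
  · rw [show r - Nat.log p i = 0 by omega]
    simpa using h.norm_le_one i

theorem sideLength_pos {p r k t : ℕ} (hp : 3 ≤ p) : 0 < sideLength p r k t := by
  unfold sideLength
  have : 0 < p - 1 := by omega
  split <;> positivity

theorem OnSide.lt_one {p r k t : ℕ} (hp : 3 ≤ p) {x : ℝ} (hx : 0 ≤ x) (h : OnSide p r k t x) :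
    x < 1 := by
  have hp' : (p : ℝ)⁻¹ < 1 := inv_lt_one_of_one_lt₀ (by exact_mod_cast (by omega : 1 < p))
  unfold OnSide at h
  split at h
  · linarith
  · rw [← h] at hp'
    exact (pow_lt_one_iff_of_nonneg hx (sideLength_pos hp).ne').1 hp'

/-- Length at least 2 means that roots on the side satisfy |x| > 1/p, which separates them from the
root on the exceptional side t = r + 1. -/
theorem two_le_sideLength {p r k t : ℕ} (hp : 3 ≤ p) (ht : t ≤ k) (hk : k ≤ r + 1)
    (htr : t ≠ r + 1) : 2 ≤ sideLength p r k t := by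
  unfold sideLength
  split
  · have : 1 ≤ p ^ (r - t) := Nat.one_le_pow _ _ (by omega)
    have : 2 ≤ p - 1 := by omega
    nlinarith
  · have : p ^ 1 ≤ p ^ (r + 1 - k) := Nat.pow_le_pow_right (by omega) (by omega)
    rw [pow_one] at this
    omega

/-- Since p - 1 ≥ 2 is prime to p, p^a (p - 1) is never a power of p, so the last side cannot have
the length of an earlier one. This uses that p is odd. -/
theorem sideLength_inj {p r k t t' : ℕ} (hp : p.Prime) (hp3 : 3 ≤ p) (ht : t ≤ k) (hk : k ≤ r + 1)
    (ht' : t' ≤ k) (h : sideLength p r k t = sideLength p r k t') : t = t' := by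
  have key : ∀ a b, p ^ a * (p - 1) ≠ p ^ b := by
    intro a b e
    have h1 : p - 1 ∣ p ^ b := e ▸ dvd_mul_left _ _
    have h2 : Nat.Coprime (p - 1) (p ^ b) :=
      Nat.Coprime.pow_right b ((Nat.coprime_self_sub_left hp.one_le).2 (Nat.coprime_one_left p))
    have := Nat.eq_one_of_dvd_coprimes h2 dvd_rfl h1
    omega
  unfold sideLength at h
  split at h <;> split at h
  · have := Nat.pow_right_injective hp.two_le (Nat.eq_of_mul_eq_mul_right (by omega) h)
    omega
  · exact absurd h (key _ _)
  · exact absurd h.symm (key _ _)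
  · omega

theorem OnSide.unique {p r k t t' : ℕ} (hp : p.Prime) (hp3 : 3 ≤ p) (ht : t ≤ k) (hk : k ≤ r + 1)
    (ht' : t' ≤ k) {x : ℝ} (hx : 0 ≤ x) (h : OnSide p r k t x) (h' : OnSide p r k t' x) :
    t = t' := by
  have h1 := h.lt_one hp3 hx
  have hp0 : 0 < (p : ℝ)⁻¹ := by have := hp.pos; positivity
  have key : ∀ l, 2 ≤ l → x ^ l = (p : ℝ)⁻¹ → (p : ℝ)⁻¹ < x := by
    intro l hl e
    rw [← e]
    have hx0 : 0 < x := by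
      rcases hx.eq_or_lt with h0 | h0
      · rw [← h0, zero_pow (by omega)] at e; exact absurd e hp0.ne
      · exact h0
    exact pow_lt_self_of_lt_one₀ hx0 h1 hl
  unfold OnSide at h h'
  split at h <;> split at h'
  · omega
  · rename_i h2
    exact absurd (key _ (two_le_sideLength hp3 ht' hk h2) h') (not_lt.2 h)
  · rename_i h2 _
    exact absurd (key _ (two_le_sideLength hp3 ht hk h2) h) (not_lt.2 h')
  · refine sideLength_inj hp hp3 ht hk ht' ?_
    have hx0 : 0 < x := hp0.trans (key _ (two_le_sideLength hp3 ht hk ‹_›) h)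
    exact (pow_right_strictAnti₀ hx0 h1).injective (h.trans h'.symm)

/-- The line carrying side t is l y + x = l t + p^(r-t) with l = p^(r-t) (p - 1). The lemma places
the lower bounds for the valuations on or above this line, strictly above beyond the endpoints of
the side. -/
theorem sideLength_mul_add_le {p t r i : ℕ} (hp : 3 ≤ p) {k : ℕ} (ht : 1 ≤ t) (htk : t < k) (hk : k ≤ r + 1)
    (hi : 1 ≤ i) :
    p ^ (r - t) * (p - 1) * t + p ^ (r - t) ≤
      p ^ (r - t) * (p - 1) * (min (r - Nat.log p i) k) + i ∧
    (i < p ^ (r - t) ∨ p ^ (r - t) * p < i → p ^ (r - t) * (p - 1) * t + p ^ (r - t) <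
      p ^ (r - t) * (p - 1) * (min (r - Nat.log p i) k) + i) := by
  have hB : 0 < p ^ (r - t) := by positivity
  have hlo := Nat.pow_log_le_self p (x := i) (by omega)
  have hhi := Nat.lt_pow_succ_log_self (b := p) (by omega) i
  set u := Nat.log p i
  have hp1 : 2 ≤ p - 1 := by omega
  rcases lt_trichotomy u (r - t) with h | h | h
  · have h1 : t + 1 ≤ min (r - u) k := by omega
    have h2 := Nat.mul_le_mul_left (p ^ (r - t) * (p - 1)) h1
    have h3 : p ^ (r - t) ≤ p ^ (r - t) * (p - 1) := Nat.le_mul_of_pos_right _ (by omega)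
    rw [Nat.mul_add, mul_one] at h2
    constructor
    · omega
    · intro _; omega
  · rw [h] at hlo hhi
    rw [show min (r - u) k = t by omega]
    rw [pow_succ] at hhi
    constructor
    · omega
    · rintro (h1 | h1) <;> omega
  · obtain ⟨v, hv⟩ : ∃ v, u = r - t + 1 + v := ⟨u - (r - t) - 1, by omega⟩
    have hw : t ≤ min (r - u) k + (v + 1) := by omega
    have h2 := Nat.mul_le_mul_left (p ^ (r - t) * (p - 1)) hw
    rw [Nat.mul_add] at h2
    rw [hv, show r - t + 1 + v = (r - t) + (v + 1) by ring, pow_add] at hlo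
    obtain ⟨h3, h4⟩ := succ_mul_le_pow hp v
    have h5 := Nat.mul_le_mul_left (p ^ (r - t)) h3
    have e : p ^ (r - t) * ((v + 1) * (p - 1) + 1) =
      p ^ (r - t) * (p - 1) * (v + 1) + p ^ (r - t) := by ring
    constructor
    · omega
    · intro hs
      rcases Nat.eq_zero_or_pos v with h0 | h0
      · subst h0
        obtain ⟨q, rfl⟩ : ∃ q, p = q + 1 := ⟨p - 1, by omega⟩
        rw [Nat.mul_add] at hs
        simp only [Nat.add_sub_cancel] at *
        rw [pow_add] at hlo
        rcases hs with hs | hs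
        · have : (q + 1) ^ (r - t) ≤ (q + 1) ^ (r - t) * (q + 1) ^ (0 + 1) :=
            Nat.le_mul_of_pos_right _ (by positivity)
          simp at hlo; nlinarith
        · omega
      · have := Nat.mul_lt_mul_of_pos_left (h4 h0) hB
        omega

/-- The analogue for the side from (0, k) to (p^(r+1-k), k - 1), on the line l y + x = l k with l =
p^(r+1-k). -/
theorem sideLength_mul_le_last {p r k i : ℕ} (hp : 3 ≤ p) (hk : k ≤ r + 1)
    (hi : 1 ≤ i) :
    p ^ (r + 1 - k) * k ≤ p ^ (r + 1 - k) * (min (r - Nat.log p i) k) + i ∧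
    (p ^ (r + 1 - k) < i → p ^ (r + 1 - k) * k <
      p ^ (r + 1 - k) * (min (r - Nat.log p i) k) + i) := by
  have hB : 0 < p ^ (r + 1 - k) := by positivity
  have hlo := Nat.pow_log_le_self p (x := i) (by omega)
  have hhi := Nat.lt_pow_succ_log_self (b := p) (by omega) i
  set u := Nat.log p i
  rcases lt_or_ge u (r + 1 - k) with h | h
  · rw [show min (r - u) k = k by omega]
    constructor
    · omega
    · intro _; omega
  · obtain ⟨v, hv⟩ : ∃ v, u = r + 1 - k + v := ⟨u - (r + 1 - k), by omega⟩
    have hw : k ≤ min (r - u) k + (v + 1) := by omega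
    have h2 := Nat.mul_le_mul_left (p ^ (r + 1 - k)) hw
    rw [Nat.mul_add] at h2
    rw [hv, pow_add] at hlo
    rcases v with _ | v
    · simp at hlo h2
      constructor
      · omega
      · intro _; omega
    · have h3 : v + 1 + 1 < p ^ (v + 1) := by
        have := (succ_mul_le_pow hp v).1
        have : 2 * (v + 1) ≤ (v + 1) * (p - 1) := by
          rw [mul_comm]; exact Nat.mul_le_mul_left _ (by omega)
        omega
      have h4 := Nat.mul_lt_mul_of_pos_left h3 hB
      constructor
      · omega
      · intro _; omega

variable [IsUltrametricDist E]

theorem HasPrimePowPolygon.countP_onSide {p r k : ℕ} {f : E[X]} (h : HasPrimePowPolygon p r k f)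
    (hp : 3 ≤ p) (hk : k ≤ r + 1) {ms : Multiset E} (hf : f = (ms.map fun β => X - C β).prod)
    {t : ℕ} (ht : 1 ≤ t) (htk : t ≤ k) [DecidablePred (OnSide p r k t)] :
    ms.countP (fun β => OnSide p r k t ‖β‖) = sideLength p r k t := by
  have hp0 : 0 < (p : ℝ)⁻¹ := by positivity
  have hp1 : (p : ℝ)⁻¹ < 1 := inv_lt_one_of_one_lt₀ (by exact_mod_cast (by omega : 1 < p))
  obtain ⟨l, hl⟩ : ∃ l, l = sideLength p r k t := ⟨_, rfl⟩
  have hl0 : l ≠ 0 := hl ▸ (sideLength_pos hp).ne'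
  -- With c^l = 1/p, a coefficient of valuation w contributes c^(l w + i) at radius c, so comparing
  -- Gauss terms becomes comparing the integers l w + i.
  obtain ⟨c, hc, hcl⟩ : ∃ c : ℝ, 0 < c ∧ c ^ l = (p : ℝ)⁻¹ :=
    ⟨((p : ℝ)⁻¹) ^ ((l : ℝ)⁻¹), by positivity, Real.rpow_inv_natCast_pow hp0.le hl0⟩
  have hc1 : c < 1 := (pow_lt_one_iff_of_nonneg hc.le hl0).1 (hcl ▸ hp1)
  have hanti := pow_right_strictAnti₀ hc hc1
  have bd : ∀ i w, ‖f.coeff i‖ ≤ ((p : ℝ)⁻¹) ^ w → ‖f.coeff i‖ * c ^ i ≤ c ^ (l * w + i) := by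
    intro i w hw
    rw [pow_add, pow_mul, hcl]
    gcongr
  have eqv : ∀ i w, ‖f.coeff i‖ = ((p : ℝ)⁻¹) ^ w → ‖f.coeff i‖ * c ^ i = c ^ (l * w + i) := by
    intro i w hw
    rw [pow_add, pow_mul, hcl, hw]
  have hroot : ∀ β : E, ‖β‖ ^ l = (p : ℝ)⁻¹ ↔ ‖β‖ = c := by
    intro β
    rw [← hcl]
    exact pow_left_inj₀ (norm_nonneg β) hc.le hl0
  rcases htk.lt_or_eq with htk' | htk'
  · have hlB : l = p ^ (r - t) * (p - 1) := by rw [hl, sideLength, if_pos htk']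
    have hlB' : p ^ (r - t) * p = l + p ^ (r - t) := by
      rw [hlB]
      obtain ⟨q, rfl⟩ : ∃ q, p = q + 1 := ⟨p - 1, by omega⟩
      simp; ring
    have hB : 0 < p ^ (r - t) := by positivity
    have hlgt : p ^ (r - t) < l := by
      rw [hlB]; exact (Nat.lt_mul_iff_one_lt_right hB).2 (by omega)
    have hM1 : ‖f.coeff (p ^ (r - t))‖ * c ^ (p ^ (r - t)) = c ^ (l * t + p ^ (r - t)) := by
      rw [eqv _ _ (h.norm_eq (r - t) (by omega) (by omega)), show r - (r - t) = t by omega]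
    have hM2 : ‖f.coeff (p ^ (r - t) * p)‖ * c ^ (p ^ (r - t) * p) =
        c ^ (l * t + p ^ (r - t)) := by
      have := eqv _ _ (h.norm_eq (r - t + 1) (by omega) (by omega))
      rw [pow_succ] at this
      rw [this, show r - (r - t + 1) = t - 1 by omega, hlB']
      congr 1
      obtain ⟨q, rfl⟩ : ∃ q, t = q + 1 := ⟨t - 1, by omega⟩
      simp; ring
    have h0 : ‖f.coeff 0‖ * c ^ 0 < c ^ (l * t + p ^ (r - t)) := by
      refine (bd 0 k h.norm_zero_le).trans_lt (hanti ?_)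
      have := Nat.mul_le_mul_left l (show t + 1 ≤ k by omega)
      rw [Nat.mul_add] at this
      omega
    have hle : ∀ i, 1 ≤ i → ‖f.coeff i‖ * c ^ i ≤ c ^ (l * t + p ^ (r - t)) := fun i hi =>
      (bd i _ (h.norm_le_log (by omega) hi)).trans (hanti.antitone (by
        rw [hlB]; exact (sideLength_mul_add_le hp ht htk' hk hi).1))
    have hlt : ∀ i, 1 ≤ i → (i < p ^ (r - t) ∨ p ^ (r - t) * p < i) →
        ‖f.coeff i‖ * c ^ i < c ^ (l * t + p ^ (r - t)) := fun i hi hi' =>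
      (bd i _ (h.norm_le_log (by omega) hi)).trans_lt (hanti (by
        rw [hlB]; exact (sideLength_mul_add_le hp ht htk' hk hi).2 hi'))
    have c1 : ms.countP (‖·‖ ≤ c) = p ^ (r - t) * p := by
      refine countP_norm_le_eq ms hf hc _ ?_ ?_
      · intro i _
        rw [hM2]
        rcases Nat.eq_zero_or_pos i with rfl | hi
        · exact h0.le
        · exact hle i hi
      · intro i hi
        rw [hM2]
        exact hlt i (by omega) (Or.inr hi)
    have c2 : ms.countP (‖·‖ < c) = p ^ (r - t) := by
      refine countP_norm_lt_eq ms hf hc _ ?_ ?_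
      · intro i hi
        rw [hM1]
        exact hle i (by omega)
      · intro i hi
        rw [hM1]
        rcases Nat.eq_zero_or_pos i with rfl | hi'
        · exact h0
        · exact hlt i hi' (Or.inl hi)
    have c3 := countP_norm_le_eq_add ms c
    have : ms.countP (fun β => OnSide p r k t ‖β‖) = ms.countP (‖·‖ = c) := by
      apply Multiset.countP_congr rfl
      intro β _
      rw [OnSide, if_neg (by omega), ← hl, hroot]
    omega
  · subst htk'
    have hlB : l = p ^ (r + 1 - t) := by rw [hl, sideLength, if_neg (lt_irrefl t)]
    have hM : ‖f.coeff l‖ * c ^ l = c ^ (l * t) := by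
      have := eqv _ _ (h.norm_eq (r + 1 - t) (by omega) (by omega))
      rw [← hlB] at this
      rw [this, show r - (r + 1 - t) = t - 1 by omega]
      congr 1
      obtain ⟨q, rfl⟩ : ∃ q, t = q + 1 := ⟨t - 1, by omega⟩
      simp; ring
    have hle : ∀ i, 1 ≤ i → ‖f.coeff i‖ * c ^ i ≤ c ^ (l * t) := fun i hi =>
      (bd i _ (h.norm_le_log (by omega) hi)).trans (hanti.antitone (by
        rw [hlB]; exact (sideLength_mul_le_last hp hk hi).1))
    have c1 : ms.countP (‖·‖ ≤ c) = l := by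
      refine countP_norm_le_eq ms hf hc _ ?_ ?_
      · intro i _
        rw [hM]
        rcases Nat.eq_zero_or_pos i with rfl | hi
        · exact bd 0 t h.norm_zero_le
        · exact hle i hi
      · intro i hi
        rw [hM]
        have hi1 : 1 ≤ i := by omega
        exact (bd i _ (h.norm_le_log (by omega) hi1)).trans_lt (hanti (by
          rw [hlB]; exact (sideLength_mul_le_last hp hk hi1).2 (hlB ▸ hi)))
    -- If t = r + 1 the constant term is only bounded above, so just the closed disc is counted;
    -- otherwise its exact size shows that no root lies in the open disc.
    by_cases htr : t = r + 1
    · have hl1 : l = 1 := by rw [hlB, htr]; simp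
      rw [← hl, ← c1]
      apply Multiset.countP_congr rfl
      intro β _
      rw [OnSide, if_pos htr, ← hcl, hl1, pow_one]
    · have c2 : ms.countP (‖·‖ < c) = 0 := by
        refine countP_norm_lt_eq ms hf hc _ ?_ (by simp)
        intro i hi
        rw [eqv 0 t (h.norm_zero_eq (by omega))]
        exact hle i hi
      have c3 := countP_norm_le_eq_add ms c
      have : ms.countP (fun β => OnSide p r t t ‖β‖) = ms.countP (‖·‖ = c) := by
        apply Multiset.countP_congr rfl
        intro β _
        rw [OnSide, if_neg htr, ← hl, hroot]
      omega

end Sides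

/-! ### Absolute values of integers -/

section IntNorm

variable {E : Type*} [NormedField E] [IsUltrametricDist E] {p : ℕ} [hp : Fact p.Prime]

theorem norm_intCast_eq_one_of_not_dvd (hE : ‖(p : E)‖ = (p : ℝ)⁻¹) {z : ℤ} (hz : ¬ (p : ℤ) ∣ z) :
    ‖(z : E)‖ = 1 := by
  have hpE : ‖(p : E)‖ < 1 := hE ▸ inv_lt_one_of_one_lt₀ (by exact_mod_cast hp.out.one_lt)
  obtain ⟨u, v, huv⟩ := (Nat.prime_iff_prime_int.1 hp.out).coprime_iff_not_dvd.2 hz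
  refine le_antisymm (IsUltrametricDist.norm_intCast_le_one E z) (not_lt.1 fun hlt => ?_)
  have h1 : (1 : E) = u * p + v * z := by
    have := congrArg (Int.cast : ℤ → E) huv
    push_cast at this
    exact this.symm
  have h2 : ‖(1 : E)‖ ≤ max ‖(u * p : E)‖ ‖(v * z : E)‖ := by
    rw [h1]; exact IsUltrametricDist.norm_add_le_max _ _
  rw [norm_one, norm_mul, norm_mul] at h2
  have hu := IsUltrametricDist.norm_intCast_le_one E u
  have hv := IsUltrametricDist.norm_intCast_le_one E v
  rcases le_max_iff.1 h2 with h | h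
  · nlinarith [norm_nonneg (p : E)]
  · nlinarith [norm_nonneg (z : E)]

theorem norm_intCast_pow_mul (hE : ‖(p : E)‖ = (p : ℝ)⁻¹) {z : ℤ} (hz : ¬ (p : ℤ) ∣ z) (k : ℕ) :
    ‖(((p : ℤ) ^ k * z : ℤ) : E)‖ = ((p : ℝ)⁻¹) ^ k := by
  push_cast
  rw [norm_mul, norm_pow, hE, norm_intCast_eq_one_of_not_dvd hE hz, mul_one]

omit hp in
theorem norm_intCast_le_of_dvd (hE : ‖(p : E)‖ = (p : ℝ)⁻¹) {z : ℤ} {k : ℕ}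
    (hz : (p : ℤ) ^ k ∣ z) : ‖(z : E)‖ ≤ ((p : ℝ)⁻¹) ^ k := by
  obtain ⟨y, rfl⟩ := hz
  push_cast
  rw [norm_mul, norm_pow, hE]
  exact mul_le_of_le_one_right (by positivity) (IsUltrametricDist.norm_intCast_le_one E y)

end IntNorm

/-! ### Primes above p through embeddings -/

section Places

variable {K : Type*} [Field K] [NumberField K] {E : Type*} [NormedField E] [IsUltrametricDist E]

/-- If |x| > 1, the leading term of a monic integral equation strictly dominates all the others. -/
theorem norm_le_one_of_isIntegral {x : E} (hx : IsIntegral ℤ x) : ‖x‖ ≤ 1 := by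
  obtain ⟨f, hf, h0⟩ := hx
  by_contra! h
  rw [← aeval_def, aeval_eq_sum_range, Finset.sum_range_succ, coeff_natDegree, hf.leadingCoeff,
    one_smul] at h0
  have h1 : ‖∑ i ∈ Finset.range f.natDegree, f.coeff i • x ^ i‖ < ‖x ^ f.natDegree‖ := by
    rcases Nat.eq_zero_or_pos f.natDegree with hd | hd
    · simp [hd]
    obtain ⟨i, hi, hle⟩ := IsUltrametricDist.exists_norm_finsetSum_le_of_nonempty
      (Finset.nonempty_range_iff.2 hd.ne') (fun i => f.coeff i • x ^ i)
    refine hle.trans_lt ?_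
    rw [zsmul_eq_mul, norm_mul, norm_pow, norm_pow]
    refine (mul_le_of_le_one_left (by positivity)
      (IsUltrametricDist.norm_intCast_le_one E _)).trans_lt ?_
    exact pow_lt_pow_right₀ h (Finset.mem_range.1 hi)
  rw [add_eq_zero_iff_eq_neg] at h0
  rw [h0, norm_neg] at h1
  exact lt_irrefl _ h1

variable [Algebra ℚ E]

theorem norm_algHom_le_one (σ : K →ₐ[ℚ] E) (x : 𝓞 K) : ‖σ x‖ ≤ 1 := by
  refine norm_le_one_of_isIntegral ?_
  exact map_isIntegral_int (σ : K →+* E) (RingOfIntegers.isIntegral_coe x)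

/-- The prime ideal of `𝓞 K` that an embedding of `K` into a `p`-adic field defines. -/
def placeIdeal (σ : K →ₐ[ℚ] E) : Ideal (𝓞 K) where
  carrier := {x | ‖σ x‖ < 1}
  add_mem' {x y} hx hy := by
    simp only [Set.mem_ofPred_eq, map_add] at *
    exact (IsUltrametricDist.norm_add_le_max _ _).trans_lt (max_lt hx hy)
  zero_mem' := by simp
  smul_mem' c x hx := by
    simp only [Set.mem_ofPred_eq, smul_eq_mul, map_mul, norm_mul] at *
    exact (mul_le_of_le_one_left (norm_nonneg _) (norm_algHom_le_one σ c)).trans_lt hx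

theorem mem_placeIdeal {σ : K →ₐ[ℚ] E} {x : 𝓞 K} : x ∈ placeIdeal σ ↔ ‖σ x‖ < 1 := Iff.rfl

theorem notMem_placeIdeal {σ : K →ₐ[ℚ] E} {x : 𝓞 K} : x ∉ placeIdeal σ ↔ ‖σ x‖ = 1 := by
  rw [mem_placeIdeal, not_lt]
  exact ⟨fun h => le_antisymm (norm_algHom_le_one σ x) h, fun h => h.ge⟩

instance placeIdeal_isPrime (σ : K →ₐ[ℚ] E) : (placeIdeal σ).IsPrime := by
  refine ⟨fun h => ?_, fun {x y} hxy => ?_⟩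
  · have : (1 : 𝓞 K) ∈ placeIdeal σ := h ▸ Submodule.mem_top
    simp [mem_placeIdeal] at this
  · by_contra! h
    rw [notMem_placeIdeal, notMem_placeIdeal] at h
    simp [mem_placeIdeal, h] at hxy

variable {p : ℕ} [hp : Fact p.Prime]

theorem natCast_mem_placeIdeal (hE : ‖(p : E)‖ = (p : ℝ)⁻¹) (σ : K →ₐ[ℚ] E) :
    (p : 𝓞 K) ∈ placeIdeal σ := by
  rw [mem_placeIdeal]
  simp only [map_natCast, hE]
  exact inv_lt_one_of_one_lt₀ (by exact_mod_cast hp.out.one_lt)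

/-- If `(π) = P * J` and `y ∈ P ^ m`, `y ∉ P ^ (m + 1)`, then `|y| = |π| ^ m` at every embedding
belonging to `P`. -/
theorem norm_eq_pow_of_span_eq {P J : Ideal (𝓞 K)} [P.IsPrime] {π : 𝓞 K}
    (hπ : Ideal.span {π} = P * J) (hP : P ≠ ⊥) (hJ : ¬ J ≤ P) {x : 𝓞 K} {m : ℕ} (hx : x ∈ P ^ m)
    (hx' : x ∉ P ^ (m + 1)) (σ : K →ₐ[ℚ] E) (hσ : placeIdeal σ = P) : ‖σ x‖ = ‖σ π‖ ^ m := by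
  obtain ⟨j, hj, hjP⟩ := SetLike.not_le_iff_exists.1 hJ
  have h1 : x * j ^ m ∈ Ideal.span {π ^ m} := by
    -- Here j ∈ J lies outside P, so x j^m ∈ P^m J^m = (π^m); the cofactor y avoids P because x ∉
    -- P^(m+1).
    rw [← Ideal.span_singleton_pow, hπ, mul_pow]
    exact Ideal.mul_mem_mul hx (Ideal.pow_mem_pow hj m)
  obtain ⟨y, hy⟩ := Ideal.mem_span_singleton.1 h1
  have hπP : π ∈ P := by
    have : π ∈ P * J := hπ ▸ Ideal.mem_span_singleton_self π
    exact Ideal.mul_le_left this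
  have hyP : y ∉ P := by
    intro hyP
    have h2 : x * j ^ m ∈ P ^ (m + 1) := by
      rw [hy, pow_succ]
      exact Ideal.mul_mem_mul (Ideal.pow_mem_pow hπP m) hyP
    exact hjP (Ideal.IsPrime.mem_of_pow_mem inferInstance _
      (Ideal.mem_prime_of_mul_mem_pow hP hx' h2))
  have hj1 : ‖σ j‖ = 1 := notMem_placeIdeal.1 (hσ ▸ hjP)
  have hy1 : ‖σ y‖ = 1 := notMem_placeIdeal.1 (hσ ▸ hyP)
  have h2 := congrArg (fun z : 𝓞 K => ‖σ z‖) hy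
  simpa [hj1, hy1] using h2

/-- By Krull's intersection theorem the powers of P meet in 0. -/
theorem exists_mem_pow_notMem_pow_succ {P : Ideal (𝓞 K)} [P.IsPrime] {x : 𝓞 K}
    (hx : x ≠ 0) : ∃ m, x ∈ P ^ m ∧ x ∉ P ^ (m + 1) := by
  classical
  have hfin : ∃ m, x ∉ P ^ m := by
    by_contra! h
    have : x ∈ ⨅ i : ℕ, P ^ i := by simpa [Submodule.mem_iInf] using h
    rw [Ideal.iInf_pow_eq_bot_of_isDomain P (Ideal.IsPrime.ne_top inferInstance)] at this
    exact hx (by simpa using this)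
  obtain ⟨m, hm⟩ : ∃ m, Nat.find hfin = m + 1 := by
    refine ⟨Nat.find hfin - 1, ?_⟩
    have : Nat.find hfin ≠ 0 := fun h => by
      have := Nat.find_spec hfin
      rw [h] at this; simp at this
    omega
  refine ⟨m, ?_, hm ▸ Nat.find_spec hfin⟩
  by_contra h
  have := Nat.find_min' hfin h
  omega

/-- Multiplication by p is invertible on 𝓞 K / J, so this finite group has no element of order p. -/
theorem not_dvd_absNorm_of_sup_eq_top {J : Ideal (𝓞 K)} (h : Ideal.span {(p : 𝓞 K)} ⊔ J = ⊤) :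
    ¬ p ∣ Ideal.absNorm J := by
  intro hd
  obtain ⟨z, hz, y, hy, hzy⟩ := Submodule.mem_sup.1 (h ▸ Submodule.mem_top : (1 : 𝓞 K) ∈ _)
  obtain ⟨w, rfl⟩ := Ideal.mem_span_singleton.1 hz
  have hinj : Function.Injective (fun q : 𝓞 K ⧸ J => p • q) := by
    have hw : ∀ q : 𝓞 K ⧸ J, Ideal.Quotient.mk J w * (p • q) = q := by
      intro q
      have h1 : (Ideal.Quotient.mk J (p * w)) = 1 := by
        rw [← map_one (Ideal.Quotient.mk J), Ideal.Quotient.eq]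
        have : (p : 𝓞 K) * w - 1 = -y := by rw [← hzy]; ring
        rw [this]; exact J.neg_mem hy
      rw [nsmul_eq_mul, ← mul_assoc, mul_comm (Ideal.Quotient.mk J w)]
      rw [map_mul, map_natCast] at h1
      rw [h1, one_mul]
    intro a b hab
    rw [← hw a, ← hw b]
    simp only at hab
    rw [hab]
  have hJ : Finite (𝓞 K ⧸ J) := by
    by_cases hJ : J = ⊥
    · have : IsUnit (p : 𝓞 K) := by
        rw [hJ, sup_bot_eq] at h
        exact Ideal.span_singleton_eq_top.1 h
      have h2 := Ideal.absNorm_span_natCast (S := 𝓞 K) p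
      rw [Ideal.span_singleton_eq_top.2 this, Ideal.absNorm_top] at h2
      have h3 : Module.finrank ℤ (𝓞 K) ≠ 0 := by
        rw [RingOfIntegers.rank]; exact (Module.finrank_pos).ne'
      exact absurd h2.symm ((Nat.one_lt_pow h3 hp.out.one_lt).ne')
    · exact Ideal.finiteQuotientOfFreeOfNeBot J hJ
  have hd' : p ∣ Nat.card (𝓞 K ⧸ J) := hd
  obtain ⟨q, hq⟩ := exists_prime_addOrderOf_dvd_card' p hd'
  have h1 : p • q = 0 := hq ▸ addOrderOf_nsmul_eq_zero q
  have h2 : q = 0 := hinj (by simpa using h1)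
  rw [h2, addOrderOf_zero] at hq
  exact hp.out.one_lt.ne hq

variable [IsAlgClosed E]

/-- The local data at a prime `P` above `p`, read off from the embeddings into a `p`-adic field:
a uniformizer, the ramification index, the residue degree, and the number of embeddings. -/
theorem exists_local_data (hE : ‖(p : E)‖ = (p : ℝ)⁻¹) {P : Ideal (𝓞 K)} [P.IsPrime]
    (hpP : (p : 𝓞 K) ∈ P) [DecidablePred fun σ : K →ₐ[ℚ] E => placeIdeal σ = P] :
    ∃ (π : 𝓞 K) (e f : ℕ), Ideal.absNorm P = p ^ f ∧ 0 < f ∧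
      (∀ σ : K →ₐ[ℚ] E, placeIdeal σ = P → ‖σ π‖ ^ e = (p : ℝ)⁻¹) ∧
      (∀ x : 𝓞 K, x ≠ 0 → ∃ m : ℕ, ∀ σ : K →ₐ[ℚ] E, placeIdeal σ = P → ‖σ x‖ = ‖σ π‖ ^ m) ∧
      (Finset.univ.filter fun σ : K →ₐ[ℚ] E => placeIdeal σ = P).card = e * f := by
  have hp0 : (p : 𝓞 K) ≠ 0 := by exact_mod_cast hp.out.ne_zero
  have hPbot : P ≠ ⊥ := by rintro rfl; exact hp0 (by simpa using hpP)
  have hPmax : P.IsMaximal := Ideal.IsPrime.isMaximal inferInstance hPbot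
  obtain ⟨q, f, hf0, hqP, hq, hf⟩ := Ideal.exists_prime_and_absNorm_eq_pow P
  have hqp : q = p := by
    by_contra hne
    have hco := (Nat.isCoprime_iff_coprime.2 ((Nat.coprime_primes hq hp.out).2 hne))
    obtain ⟨u, v, huv⟩ := hco
    have h1 : (1 : 𝓞 K) = u * q + v * p := by
      have := congrArg (Int.cast : ℤ → 𝓞 K) huv
      push_cast at this
      exact this.symm
    exact hPmax.ne_top ((Ideal.eq_top_iff_one P).2
      (h1 ▸ P.add_mem (P.mul_mem_left _ hqP) (P.mul_mem_left _ hpP)))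
  subst hqp
  -- The choice (p) P + (π) = P makes π a uniformizer at P and a unit at every other prime above p:
  -- in (π) = P J the ideal J is prime to p.
  obtain ⟨π, hπ⟩ := IsDedekindDomain.exists_sup_span_eq
    (I := Ideal.span {(q : 𝓞 K)} * P) (J := P) Ideal.mul_le_right
    (mul_ne_zero (by simpa using hq.ne_zero) hPbot)
  have hπP : Ideal.span {π} ≤ P := by
    conv_rhs => rw [← hπ]
    exact le_sup_right
  obtain ⟨J, hJ⟩ := Ideal.dvd_iff_le.2 hπP
  have hsup : Ideal.span {(q : 𝓞 K)} ⊔ J = ⊤ := by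
    have h1 : P * (Ideal.span {(q : 𝓞 K)} ⊔ J) = P * ⊤ := by
      rw [Ideal.mul_sup, ← hJ, mul_comm P, hπ, Ideal.mul_top]
    exact mul_left_cancel₀ hPbot h1
  have hJP : ¬ J ≤ P := fun h => hPmax.ne_top (top_le_iff.1
    (hsup ▸ sup_le ((Ideal.span_singleton_le_iff_mem P).2 hpP) h))
  have hπ0 : π ≠ 0 := by
    rintro rfl
    rw [Ideal.span_singleton_zero] at hJ
    rcases mul_eq_zero.1 hJ.symm with h | h
    · exact hPbot h
    · exact hJP (h ▸ bot_le)
  have hval : ∀ x : 𝓞 K, x ≠ 0 → ∃ m : ℕ, ∀ σ : K →ₐ[ℚ] E, placeIdeal σ = P →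
      ‖σ x‖ = ‖σ π‖ ^ m := fun x hx => by
    obtain ⟨m, hm, hm'⟩ := exists_mem_pow_notMem_pow_succ (P := P) hx
    exact ⟨m, fun σ hσ => norm_eq_pow_of_span_eq hJ hPbot hJP hm hm' σ hσ⟩
  obtain ⟨e, he⟩ := hval q hp0
  have he' : ∀ σ : K →ₐ[ℚ] E, placeIdeal σ = P → ‖σ π‖ ^ e = (q : ℝ)⁻¹ := fun σ hσ => by
    rw [← he σ hσ]; simpa using hE
  refine ⟨π, e, f, hf, hf0, he', hval, ?_⟩
  have hother : ∀ σ : K →ₐ[ℚ] E, placeIdeal σ ≠ P → ‖σ π‖ = 1 := fun σ hσ => by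
    rw [← notMem_placeIdeal]
    intro hmem
    have h1 : P * J ≤ placeIdeal σ := hJ ▸ (Ideal.span_singleton_le_iff_mem _).2 hmem
    rcases (Ideal.IsPrime.mul_le inferInstance).1 h1 with h | h
    · exact hσ (hPmax.eq_of_le (Ideal.IsPrime.ne_top inferInstance) h).symm
    · exact Ideal.IsPrime.ne_top (I := placeIdeal σ) inferInstance (top_le_iff.1
        (hsup ▸ sup_le ((Ideal.span_singleton_le_iff_mem _).2 (natCast_mem_placeIdeal hE σ)) h))
  -- The norm of π has p-part exactly p^f. It is also the product of all σ π, to which only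
  -- embeddings at P contribute; raising this to the power e turns each factor into 1/p and counts e
  -- f embeddings.
  have hnorm : ‖((Algebra.norm ℤ π : ℤ) : E)‖ = ((q : ℝ)⁻¹) ^ f := by
    have h1 : (Algebra.norm ℤ π).natAbs = q ^ f * Ideal.absNorm J := by
      rw [← Ideal.absNorm_span_singleton, hJ, map_mul, hf]
    have h2 : ‖(((Algebra.norm ℤ π).natAbs : ℤ) : E)‖ = ((q : ℝ)⁻¹) ^ f := by
      rw [h1]
      push_cast
      have := norm_intCast_pow_mul hE (z := Ideal.absNorm J)
        (by exact_mod_cast not_dvd_absNorm_of_sup_eq_top hsup) f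
      exact_mod_cast this
    rcases Int.natAbs_eq (Algebra.norm ℤ π) with h | h
    · rw [h]; exact h2
    · rw [h, Int.cast_neg, norm_neg]; exact h2
  have hprod : ((Algebra.norm ℤ π : ℤ) : E) = ∏ σ : K →ₐ[ℚ] E, σ π := by
    rw [← Algebra.norm_eq_prod_embeddings, ← Algebra.coe_norm_int]
    simp
  rw [hprod, norm_prod, ← Finset.prod_filter_mul_prod_filter_not _ (fun σ => placeIdeal σ = P),
    Finset.prod_eq_one (s := Finset.univ.filter fun σ => ¬ placeIdeal σ = P)
      (fun σ hσ => hother σ (Finset.mem_filter.1 hσ).2), mul_one] at hnorm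
  have h3 := congrArg (· ^ e) hnorm
  simp only [← Finset.prod_pow] at h3
  rw [Finset.prod_congr rfl (fun σ hσ => he' σ (Finset.mem_filter.1 hσ).2),
    Finset.prod_const, ← pow_mul] at h3
  have hq1 : (q : ℝ)⁻¹ < 1 := inv_lt_one_of_one_lt₀ (by exact_mod_cast hq.one_lt)
  have hq0 : 0 < (q : ℝ)⁻¹ := by have := hq.pos; positivity
  rw [mul_comm e f]
  exact (pow_right_strictAnti₀ hq0 hq1).injective h3

end Places

/-! ### Dedekind's bound when p does not divide the index -/

section IndexBound

variable {p : ℕ} [hp : Fact p.Prime]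

theorem finite_monic_irreducible_natDegree_eq (d : ℕ) :
    {g : (ZMod p)[X] | g.Monic ∧ Irreducible g ∧ g.natDegree = d}.Finite := by
  have hfin : Finite (degreeLT (ZMod p) (d + 1)) :=
    (degreeLTEquiv (ZMod p) (d + 1)).toEquiv.finite_iff.2 inferInstance
  refine Set.Finite.subset (Set.toFinite (degreeLT (ZMod p) (d + 1) : Set (ZMod p)[X])) ?_
  rintro g ⟨-, -, hd⟩
  rw [SetLike.mem_coe, mem_degreeLT]
  exact degree_le_natDegree.trans_lt (by rw [hd]; exact_mod_cast Nat.lt_succ_self d)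

theorem natDegree_minpoly_of_forall_exists_aeval_eq {κ : Type*} [Field κ] [Algebra (ZMod p) κ]
    {d : ℕ} (hcard : Nat.card κ = p ^ d) {y : κ} (hy : ∀ x, ∃ q : (ZMod p)[X], aeval y q = x) :
    (minpoly (ZMod p) y).natDegree = d := by
  have : Finite κ := Nat.finite_of_card_ne_zero (by
    rw [hcard]; exact (pow_pos hp.out.pos d).ne')
  have htop : IntermediateField.adjoin (ZMod p) {y} = ⊤ := by
    rw [eq_top_iff]
    rintro x -
    obtain ⟨q, rfl⟩ := hy x
    exact IntermediateField.algebra_adjoin_le_adjoin _ _ (aeval_mem_adjoin_singleton _ y)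
  have h1 := (Field.primitive_element_iff_minpoly_natDegree_eq (ZMod p) y).1 htop
  have h2 : Nat.card κ = p ^ Module.finrank (ZMod p) κ := by
    rw [Module.natCard_eq_pow_finrank (K := ZMod p), Nat.card_zmod]
  rw [h1]
  exact Nat.pow_right_injective hp.out.two_le (h2.symm.trans hcard)

variable {K : Type*} [Field K] [NumberField K]

/-- The index annihilates the quotient group. An infinite index is recorded as 0, where the claim is
trivial; the hypothesis that p does not divide the index excludes that value later. -/
theorem elementIndex_nsmul_mem (η x : 𝓞 K) :
    ∃ q : ℤ[X], aeval η q = (elementIndex η : 𝓞 K) * x := by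
  have h := AddSubgroup.nsmul_index_mem
    (Subalgebra.toSubmodule (Algebra.adjoin ℤ {η})).toAddSubgroup x
  have h2 : elementIndex η • x ∈ Algebra.adjoin ℤ {η} := h
  rw [Algebra.adjoin_singleton_eq_range_aeval] at h2
  obtain ⟨q, hq⟩ := h2
  exact ⟨q, by rw [← nsmul_eq_mul]; exact hq⟩

/-- If `p` does not divide the index of `ℤ[η]`, the primes above `p` of norm `p ^ d` correspond to
irreducible polynomials of degree `d` that determine when polynomials in `η` lie in the prime. -/
theorem exists_irreducible_of_not_dvd_elementIndex {η : 𝓞 K} (hη : ¬ p ∣ elementIndex η)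
    {P : Ideal (𝓞 K)} [hP : P.IsPrime] (hpP : (p : 𝓞 K) ∈ P) {d : ℕ}
    (hd : Ideal.absNorm P = p ^ d) :
    ∃ g : (ZMod p)[X], (g.Monic ∧ Irreducible g ∧ g.natDegree = d) ∧
      ∀ h : ℤ[X], aeval η h ∈ P ↔ g ∣ h.map (Int.castRingHom (ZMod p)) := by
  have hPbot : P ≠ ⊥ := by
    rintro rfl
    have : (p : 𝓞 K) = 0 := by simpa using hpP
    exact hp.out.ne_zero (by exact_mod_cast this)
  have hPmax : P.IsMaximal := hP.isMaximal hPbot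
  let := Ideal.Quotient.field P
  have hchar : CharP (𝓞 K ⧸ P) p := by
    have h0 : ((p : ℕ) : 𝓞 K ⧸ P) = 0 := by
      rw [← map_natCast (Ideal.Quotient.mk P)]
      exact Ideal.Quotient.eq_zero_iff_mem.2 hpP
    exact (CharP.charP_iff_prime_eq_zero hp.out).2 h0
  let := ZMod.algebra (𝓞 K ⧸ P) p
  set y := Ideal.Quotient.mk P η with hy
  have hev : ∀ h : ℤ[X], aeval y (h.map (Int.castRingHom (ZMod p))) =
      Ideal.Quotient.mk P (aeval η h) := by
    intro h
    rw [aeval_def, eval₂_map, aeval_def, hom_eval₂]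
    congr 1
    exact RingHom.ext_int _ _
  have hcard : Nat.card (𝓞 K ⧸ P) = p ^ d := hd
  have : Finite (𝓞 K ⧸ P) := Nat.finite_of_card_ne_zero (by
    rw [hcard]; exact (pow_pos hp.out.pos d).ne')
  have hint : IsIntegral (ZMod p) y := Algebra.IsIntegral.isIntegral y
  refine ⟨minpoly (ZMod p) y, ⟨minpoly.monic hint, minpoly.irreducible hint, ?_⟩, ?_⟩
  · refine natDegree_minpoly_of_forall_exists_aeval_eq hcard fun x => ?_
    obtain ⟨x, rfl⟩ := Ideal.Quotient.mk_surjective x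
    obtain ⟨q, hq⟩ := elementIndex_nsmul_mem η x
    have hN : ((elementIndex η : ℕ) : ZMod p) ≠ 0 := by
      rwa [Ne, ZMod.natCast_eq_zero_iff]
    refine ⟨C ((elementIndex η : ZMod p)⁻¹) * q.map (Int.castRingHom (ZMod p)), ?_⟩
    rw [map_mul, hev, hq, aeval_C, map_mul, map_natCast, ← mul_assoc,
      ← map_natCast (algebraMap (ZMod p) (𝓞 K ⧸ P)), ← map_mul, inv_mul_cancel₀ hN, map_one,
      one_mul]
  · intro h
    rw [minpoly.dvd_iff, hev, Ideal.Quotient.eq_zero_iff_mem]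

/-- A prime P is recovered from its polynomial: the index N is a unit modulo each prime above p, so
x ∈ P can be tested on N x, which is a polynomial in η. -/
theorem ncard_primes_le_numIrred {η : 𝓞 K} (hη : ¬ p ∣ elementIndex η) (d : ℕ) :
    {P : Ideal (𝓞 K) | P.IsPrime ∧ (p : 𝓞 K) ∈ P ∧ Ideal.absNorm P = p ^ d}.Finite ∧
    {P : Ideal (𝓞 K) | P.IsPrime ∧ (p : 𝓞 K) ∈ P ∧ Ideal.absNorm P = p ^ d}.ncard
      ≤ numIrred p d := by
  have hex : ∀ P ∈ {P : Ideal (𝓞 K) | P.IsPrime ∧ (p : 𝓞 K) ∈ P ∧ Ideal.absNorm P = p ^ d},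
      ∃ g : (ZMod p)[X], (g.Monic ∧ Irreducible g ∧ g.natDegree = d) ∧
      ∀ h : ℤ[X], aeval η h ∈ P ↔ g ∣ h.map (Int.castRingHom (ZMod p)) := by
    rintro P ⟨hP, hpP, hd⟩
    exact exists_irreducible_of_not_dvd_elementIndex hη hpP hd
  choose! g hg hmem using hex
  have hle : ∀ P P' : Ideal (𝓞 K), P'.IsPrime → (p : 𝓞 K) ∈ P' →
      (∀ h : ℤ[X], aeval η h ∈ P → aeval η h ∈ P') → P ≤ P' := by
    intro P P' hP' hpP' H x hx
    obtain ⟨q, hq⟩ := elementIndex_nsmul_mem η x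
    have h1 : aeval η q ∈ P' := H q (hq ▸ P.mul_mem_left _ hx)
    rw [hq] at h1
    refine (hP'.mem_or_mem h1).resolve_left fun h2 => ?_
    obtain ⟨u, v, huv⟩ := Nat.isCoprime_iff_coprime.2 (hp.out.coprime_iff_not_dvd.2 hη)
    have h3 : (1 : 𝓞 K) = u * p + v * elementIndex η := by
      have := congrArg (Int.cast : ℤ → 𝓞 K) huv
      push_cast at this
      exact this.symm
    exact hP'.ne_top ((Ideal.eq_top_iff_one P').2
      (h3 ▸ P'.add_mem (P'.mul_mem_left _ hpP') (P'.mul_mem_left _ h2)))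
  have hinj : Set.InjOn g
      {P : Ideal (𝓞 K) | P.IsPrime ∧ (p : 𝓞 K) ∈ P ∧ Ideal.absNorm P = p ^ d} := by
    intro P hP P' hP' hgg
    apply le_antisymm
    · exact hle P P' hP'.1 hP'.2.1 fun h hh => (hmem P' hP' h).2 (hgg ▸ (hmem P hP h).1 hh)
    · exact hle P' P hP.1 hP.2.1 fun h hh => (hmem P hP h).2 (hgg ▸ (hmem P' hP' h).1 hh)
  have hfin := finite_monic_irreducible_natDegree_eq (p := p) d
  exact ⟨Set.Finite.of_injOn (fun P hP => hg P hP) hinj hfin,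
    Set.ncard_le_ncard_of_injOn g (fun P hP => hg P hP) hinj hfin⟩

theorem not_isMonogenicField_of_dvd_fieldIndex (h : p ∣ fieldIndex K) :
    ¬ IsMonogenicField K := by
  rintro ⟨η, hη⟩
  have h1 : elementIndex η = 1 := by
    unfold elementIndex
    rw [hη]
    exact AddSubgroup.index_top
  have h2 : IntermediateField.adjoin ℚ {(η : K)} = ⊤ := by
    rw [eq_top_iff]
    rintro x -
    obtain ⟨a, b, hb, rfl⟩ := IsFractionRing.div_surjective (A := 𝓞 K) x
    have hmem : ∀ a : 𝓞 K, (algebraMap (𝓞 K) K a) ∈ IntermediateField.adjoin ℚ {(η : K)} := by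
      intro a
      have ha : a ∈ Algebra.adjoin ℤ {η} := hη ▸ Algebra.mem_top
      rw [Algebra.adjoin_singleton_eq_range_aeval] at ha
      obtain ⟨q, rfl⟩ := ha
      have : algebraMap (𝓞 K) K (aeval η q) = aeval (η : K) (q.map (Int.castRingHom ℚ)) := by
        rw [← algebraMap_int_eq, aeval_map_algebraMap, ← aeval_algebraMap_apply]
      have h4 : algebraMap (𝓞 K) K ((aeval η : ℤ[X] →ₐ[ℤ] 𝓞 K) q) ∈
          (IntermediateField.adjoin ℚ {(η : K)}).toSubalgebra := by
        rw [this]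
        exact IntermediateField.algebra_adjoin_le_adjoin _ _ (aeval_mem_adjoin_singleton _ _)
      exact h4
    exact div_mem (hmem a) (hmem b)
  have h3 := (dvd_fieldIndex_iff K p).1 h η h2
  rw [h1, Nat.dvd_one] at h3
  exact hp.out.ne_one h3

end IndexBound

/-! ### Reduction modulo p in the unit ball and lifted roots -/

section UnitBall

variable {E : Type*} [NormedField E]

/-- The value f(x) is the product of the x - γ, so some factor has absolute value below 1. -/
theorem exists_root_norm_sub_lt_one [IsAlgClosed E] {f : E[X]} (hf : f.Monic) {x : E} (h : ‖f.eval x‖ < 1) :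
    ∃ γ ∈ f.roots, ‖x - γ‖ < 1 := by
  by_contra! hc
  have h1 := (IsAlgClosed.splits f).eq_prod_roots_of_monic hf
  rw [h1, eval_multiset_prod, Multiset.map_map] at h
  have key : ∀ ms : Multiset E, (∀ γ ∈ ms, 1 ≤ ‖x - γ‖) →
      1 ≤ ‖(ms.map ((fun q => eval x q) ∘ fun γ => X - C γ)).prod‖ := by
    intro ms
    induction ms using Multiset.induction_on with
    | empty => simp
    | cons γ ms ih =>
      intro hms
      rw [Multiset.map_cons, Multiset.prod_cons, norm_mul]
      have h2 := hms γ (Multiset.mem_cons_self γ ms)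
      have h3 := ih fun γ' h' => hms γ' (Multiset.mem_cons_of_mem h')
      simpa using one_le_mul_of_one_le_of_one_le (by simpa using h2) h3
  exact absurd h (not_lt.2 (key _ hc))

theorem prod_sub_roots_X_pow_add [IsAlgClosed E] [CharZero E] (s : ℕ) (hs : s ≠ 0) (b x : E) (hb : b ≠ 0) [DecidableEq E] :
    ∏ α ∈ (X ^ s + C b : E[X]).roots.toFinset, (x - α) = x ^ s + b := by
  have hmonic : (X ^ s + C b : E[X]).Monic := monic_X_pow_add_C b hs
  have hsep : (X ^ s + C b : E[X]).Separable := by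
    have := separable_X_pow_sub_C (-b) (n := s) (by exact_mod_cast hs) (neg_ne_zero.2 hb)
    simpa using this
  have h1 := (IsAlgClosed.splits (X ^ s + C b : E[X])).eq_prod_roots_of_monic hmonic
  have h2 := congrArg (eval x) h1
  rw [eval_multiset_prod, Multiset.map_map] at h2
  rw [Finset.prod, Multiset.toFinset_val, (Multiset.dedup_eq_self.2 (nodup_roots hsep))]
  simpa [Function.comp_def] using h2.symm

variable [IsUltrametricDist E]

theorem norm_aeval_int_le_one {x : E} (hx : ‖x‖ ≤ 1) (h : ℤ[X]) : ‖aeval x h‖ ≤ 1 := by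
  rw [aeval_eq_sum_range]
  refine IsUltrametricDist.norm_sum_le_of_forall_le_of_nonneg zero_le_one fun i _ => ?_
  rw [zsmul_eq_mul, norm_mul, norm_pow]
  exact mul_le_one₀ (IsUltrametricDist.norm_intCast_le_one E _) (by positivity)
    (pow_le_one₀ (norm_nonneg x) hx)

theorem norm_pow_sub_pow_le {x y : E} (hx : ‖x‖ ≤ 1) (hy : ‖y‖ ≤ 1) (i : ℕ) :
    ‖x ^ i - y ^ i‖ ≤ ‖x - y‖ := by
  induction i with
  | zero => simp
  | succ i ih =>
    rw [show x ^ (i + 1) - y ^ (i + 1) = (x ^ i - y ^ i) * x + y ^ i * (x - y) by ring]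
    refine (IsUltrametricDist.norm_add_le_max _ _).trans (max_le ?_ ?_)
    · rw [norm_mul]
      exact (mul_le_of_le_one_right (norm_nonneg _) hx).trans ih
    · rw [norm_mul, norm_pow]
      exact mul_le_of_le_one_left (norm_nonneg _) (pow_le_one₀ (norm_nonneg y) hy)

theorem norm_aeval_sub_aeval_le {x y : E} (hx : ‖x‖ ≤ 1) (hy : ‖y‖ ≤ 1) (h : ℤ[X]) :
    ‖aeval x h - aeval y h‖ ≤ ‖x - y‖ := by
  rw [aeval_eq_sum_range, aeval_eq_sum_range, ← Finset.sum_sub_distrib]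
  refine IsUltrametricDist.norm_sum_le_of_forall_le_of_nonneg (norm_nonneg _) fun i _ => ?_
  rw [zsmul_eq_mul, zsmul_eq_mul, ← mul_sub, norm_mul]
  exact (mul_le_of_le_one_left (norm_nonneg _)
    (IsUltrametricDist.norm_intCast_le_one E _)).trans (norm_pow_sub_pow_le hx hy i)

theorem norm_lt_one_of_sub {x y : E} (hx : ‖x‖ < 1) (h : ‖x - y‖ < 1) : ‖y‖ < 1 := by
  rw [show y = x - (x - y) by ring]
  exact (norm_sub_le_max_of_ultrametric _ _).trans_lt (max_lt hx h)

variable {p : ℕ} [hp : Fact p.Prime]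

theorem norm_aeval_lt_one_of_map_eq_zero (hE : ‖(p : E)‖ = (p : ℝ)⁻¹) {x : E} (hx : ‖x‖ ≤ 1)
    {h : ℤ[X]} (hh : h.map (Int.castRingHom (ZMod p)) = 0) : ‖aeval x h‖ < 1 := by
  obtain ⟨q, rfl⟩ : C (p : ℤ) ∣ h := by
    rw [C_dvd_iff_dvd_coeff]
    intro i
    have := congrArg (fun f => coeff f i) hh
    simpa [ZMod.intCast_zmod_eq_zero_iff_dvd] using this
  have hpE : ‖(p : E)‖ < 1 := hE ▸ inv_lt_one_of_one_lt₀ (by exact_mod_cast hp.out.one_lt)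
  rw [map_mul, norm_mul, aeval_C]
  simp only [algebraMap_int_eq, eq_intCast, Int.cast_natCast]
  exact (mul_le_of_le_one_right (norm_nonneg _) (norm_aeval_int_le_one hx q)).trans_lt hpE

theorem norm_aeval_lt_one_of_dvd (hE : ‖(p : E)‖ = (p : ℝ)⁻¹) {x : E} (hx : ‖x‖ ≤ 1)
    {h₁ h₂ : ℤ[X]}
    (hh : h₁.map (Int.castRingHom (ZMod p)) ∣ h₂.map (Int.castRingHom (ZMod p)))
    (h1 : ‖aeval x h₁‖ < 1) : ‖aeval x h₂‖ < 1 := by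
  obtain ⟨q, hq⟩ := hh
  obtain ⟨q, rfl⟩ := map_surjective _ (ZMod.ringHom_surjective (Int.castRingHom (ZMod p))) q
  have h2 := norm_aeval_lt_one_of_map_eq_zero hE hx (h := h₁ * q - h₂) (by
    rw [Polynomial.map_sub, Polynomial.map_mul, hq, sub_self])
  rw [map_sub, map_mul] at h2
  refine norm_lt_one_of_sub ?_ h2
  rw [norm_mul]
  exact (mul_le_of_le_one_right (norm_nonneg _) (norm_aeval_int_le_one hx q)).trans_lt h1

/-- A Bézout relation modulo p, lifted to ℤ[X], prevents both values from being small. -/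
theorem norm_aeval_eq_one_of_not_dvd (hE : ‖(p : E)‖ = (p : ℝ)⁻¹) {x : E} (hx : ‖x‖ ≤ 1)
    {h₁ h₂ : ℤ[X]} (hirr : Irreducible (h₁.map (Int.castRingHom (ZMod p))))
    (hh : ¬ h₁.map (Int.castRingHom (ZMod p)) ∣ h₂.map (Int.castRingHom (ZMod p)))
    (h1 : ‖aeval x h₁‖ < 1) : ‖aeval x h₂‖ = 1 := by
  refine le_antisymm (norm_aeval_int_le_one hx _) (not_lt.1 fun h2 => ?_)
  obtain ⟨u, v, huv⟩ := hirr.coprime_iff_not_dvd.2 hh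
  obtain ⟨u, rfl⟩ := map_surjective _ (ZMod.ringHom_surjective (Int.castRingHom (ZMod p))) u
  obtain ⟨v, rfl⟩ := map_surjective _ (ZMod.ringHom_surjective (Int.castRingHom (ZMod p))) v
  have h3 : ‖aeval x (u * h₁ + v * h₂)‖ < 1 := by
    rw [map_add, map_mul, map_mul]
    refine (IsUltrametricDist.norm_add_le_max _ _).trans_lt (max_lt ?_ ?_) <;> rw [norm_mul]
    · exact (mul_le_of_le_one_left (norm_nonneg _) (norm_aeval_int_le_one hx _)).trans_lt h1
    · exact (mul_le_of_le_one_left (norm_nonneg _) (norm_aeval_int_le_one hx _)).trans_lt h2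
  have h4 := norm_aeval_lt_one_of_dvd hE hx (h₂ := 1) (by
    rw [Polynomial.map_add, Polynomial.map_mul, Polynomial.map_mul, huv, Polynomial.map_one]) h3
  simp at h4

theorem norm_eq_one_of_pow_eq_neg (hE : ‖(p : E)‖ = (p : ℝ)⁻¹) {s : ℕ} {b : ℤ} (hs : s ≠ 0)
    (hb : ¬ (p : ℤ) ∣ b) {α : E} (hα : α ^ s = -b) : ‖α‖ = 1 := by
  have h := congrArg norm hα
  rw [norm_pow, norm_neg, norm_intCast_eq_one_of_not_dvd hE hb] at h
  exact (pow_eq_one_iff_of_nonneg (norm_nonneg α) hs).1 h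

/-- For x ≠ y the sum of the x^i y^(s-1-i) vanishes, whereas x ≡ y would make it congruent to the
unit s y^(s-1). -/
theorem norm_sub_eq_one_of_pow_eq (hE : ‖(p : E)‖ = (p : ℝ)⁻¹) {s : ℕ} (hs : ¬ p ∣ s)
    {x y : E} (hx : ‖x‖ = 1) (hy : ‖y‖ = 1) (hxy : x ^ s = y ^ s) (hne : x ≠ y) :
    ‖x - y‖ = 1 := by
  refine le_antisymm ((norm_sub_le_max_of_ultrametric _ _).trans (by simp [hx, hy]))
    (not_lt.1 fun hlt => ?_)
  have h0 : ∑ i ∈ Finset.range s, x ^ i * y ^ (s - 1 - i) = 0 := by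
    have := (Commute.all x y).geom_sum₂_mul s
    rw [hxy, sub_self] at this
    exact (mul_eq_zero.1 this).resolve_right (sub_ne_zero.2 hne)
  have h1 : ∑ i ∈ Finset.range s, (x ^ i - y ^ i) * y ^ (s - 1 - i) = -(s * y ^ (s - 1)) := by
    simp only [sub_mul, Finset.sum_sub_distrib, h0, zero_sub]
    rw [Finset.sum_congr rfl (g := fun _ => y ^ (s - 1)) (fun i hi => by
      rw [← pow_add]; congr 1; have := Finset.mem_range.1 hi; omega)]
    simp
  have h2 : ‖∑ i ∈ Finset.range s, (x ^ i - y ^ i) * y ^ (s - 1 - i)‖ ≤ ‖x - y‖ :=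
    IsUltrametricDist.norm_sum_le_of_forall_le_of_nonneg (norm_nonneg _) fun i _ => by
      rw [norm_mul, norm_pow, hy, one_pow, mul_one]
      exact norm_pow_sub_pow_le hx.le hy.le i
  have h3 : ‖(s : E)‖ = 1 := by
    have := norm_intCast_eq_one_of_not_dvd hE (z := s) (by exact_mod_cast hs)
    simpa using this
  rw [h1, norm_neg, norm_mul, norm_pow, hy, h3, one_pow, mul_one] at h2
  linarith

variable [IsAlgClosed E] [CharZero E]

/-- The roots `α` of `X ^ s + b` in a `p`-adic field which reduce to a root of a given irreducible
factor of `X ^ s + b` modulo `p`. -/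
theorem exists_finset_lifted_roots (hE : ‖(p : E)‖ = (p : ℝ)⁻¹) {s : ℕ} {b : ℤ} (hs : ¬ p ∣ s)
    (hb : ¬ (p : ℤ) ∣ b) {φ : ℤ[X]} (hφ : φ.Monic) (hd : 0 < φ.natDegree)
    (hdvd : φ.map (Int.castRingHom (ZMod p)) ∣ X ^ s + C (b : ZMod p)) :
    ∃ A : Finset E, A.card ≤ φ.natDegree ∧ A.Nonempty ∧
      (∀ α ∈ A, α ^ s = -b ∧ ‖aeval α φ‖ < 1) ∧
      (∀ x : E, ‖x‖ ≤ 1 → ‖aeval x φ‖ < 1 → ∃ α ∈ A, ‖x - α‖ < 1) ∧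
      (∀ α ∈ A, ∀ x : E, ‖x‖ ≤ 1 → ‖x - α‖ < 1 →
        ‖x ^ s + b‖ = ‖x - α‖ ∧ ‖aeval x φ‖ < 1) := by
  classical
  have hs0 : s ≠ 0 := by rintro rfl; simp at hs
  have hb0 : (b : E) ≠ 0 := by
    have : b ≠ 0 := by rintro rfl; simp at hb
    exact_mod_cast this
  set R := (X ^ s + C (b : E) : E[X]).roots.toFinset with hR
  have hmemR : ∀ α, α ∈ R ↔ α ^ s = -b := by
    intro α
    rw [hR, Multiset.mem_toFinset, mem_roots (monic_X_pow_add_C (b : E) hs0).ne_zero]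
    simp [add_eq_zero_iff_eq_neg]
  have hR1 : ∀ α ∈ R, ‖α‖ = 1 := fun α hα =>
    norm_eq_one_of_pow_eq_neg hE hs0 hb ((hmemR α).1 hα)
  have hdist : ∀ α ∈ R, ∀ α' ∈ R, α ≠ α' → ‖α - α'‖ = 1 := fun α hα α' hα' hne =>
    norm_sub_eq_one_of_pow_eq hE hs (hR1 α hα) (hR1 α' hα')
      (((hmemR α).1 hα).trans ((hmemR α').1 hα').symm) hne
  have hclose : ∀ x : E, ‖x‖ ≤ 1 → ‖aeval x φ‖ < 1 → ∃ α ∈ R, ‖x - α‖ < 1 := by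
    intro x hx hφx
    have h1 := norm_aeval_lt_one_of_dvd hE hx (h₂ := X ^ s + C b) (by simpa using hdvd) hφx
    obtain ⟨γ, hγ, hlt⟩ := exists_root_norm_sub_lt_one (f := X ^ s + C (b : E)) (x := x)
      (monic_X_pow_add_C (b : E) hs0) (by simpa using h1)
    exact ⟨γ, Multiset.mem_toFinset.2 hγ, hlt⟩
  have hφclose : ∀ x y : E, ‖x‖ ≤ 1 → ‖y‖ ≤ 1 → ‖x - y‖ < 1 → ‖aeval x φ‖ < 1 →
      ‖aeval y φ‖ < 1 := fun x y hx hy hxy h =>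
    norm_lt_one_of_sub h ((norm_aeval_sub_aeval_le hx hy φ).trans_lt hxy)
  have hEmonic : (φ.map (Int.castRingHom E)).Monic := hφ.map _
  refine ⟨R.filter fun α => ‖aeval α φ‖ < 1, ?_, ?_, ?_, ?_, ?_⟩
  · have hex : ∀ α ∈ R.filter fun α => ‖aeval α φ‖ < 1,
        ∃ γ ∈ (φ.map (Int.castRingHom E)).roots, ‖α - γ‖ < 1 := by
      intro α hα
      refine exists_root_norm_sub_lt_one hEmonic ?_
      rw [eval_map, ← algebraMap_int_eq, ← aeval_def]
      exact (Finset.mem_filter.1 hα).2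
    choose! γ hγ hγ' using hex
    -- Each α is close to a root of φ, and roots of X^s + b at mutual distance 1 cannot share one;
    -- hence there are at most deg φ of them.
    have hcard : (R.filter fun α => ‖aeval α φ‖ < 1).card ≤
        (φ.map (Int.castRingHom E)).roots.toFinset.card := by
      refine Finset.card_le_card_of_injOn γ (fun α hα => Multiset.mem_toFinset.2 (hγ α hα)) ?_
      intro α hα α' hα' hαα'
      by_contra hne
      have h1 := hdist α (Finset.mem_filter.1 hα).1 α' (Finset.mem_filter.1 hα').1 hne
      have h2 : ‖α - α'‖ < 1 := by
        rw [show α - α' = (α - γ α) - (α' - γ α') by rw [hαα']; ring]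
        exact (norm_sub_le_max_of_ultrametric _ _).trans_lt (max_lt (hγ' α hα) (hγ' α' hα'))
      linarith
    refine hcard.trans ((Multiset.toFinset_card_le _).trans ((card_roots' _).trans ?_))
    exact natDegree_map_le
  · obtain ⟨γ, hγ⟩ := IsAlgClosed.exists_root (φ.map (Int.castRingHom E)) (by
      rw [degree_eq_natDegree hEmonic.ne_zero, hφ.natDegree_map]
      exact_mod_cast hd.ne')
    have hγ0 : aeval γ φ = 0 := by
      rw [aeval_def, algebraMap_int_eq, ← eval_map]; exact hγ
    have hγ1 : ‖γ‖ ≤ 1 := norm_le_one_of_isIntegral ⟨φ, hφ, hγ0⟩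
    obtain ⟨α, hα, hlt⟩ := hclose γ hγ1 (by simp [hγ0])
    exact ⟨α, Finset.mem_filter.2 ⟨hα, hφclose γ α hγ1 (hR1 α hα).le hlt (by simp [hγ0])⟩⟩
  · intro α hα
    rw [Finset.mem_filter, hmemR] at hα
    exact hα
  · intro x hx hφx
    obtain ⟨α, hα, hlt⟩ := hclose x hx hφx
    exact ⟨α, Finset.mem_filter.2 ⟨hα, hφclose x α hx (hR1 α hα).le hlt hφx⟩, hlt⟩
  · intro α hα x hx hlt
    obtain ⟨hαR, hαφ⟩ := Finset.mem_filter.1 hα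
    refine ⟨?_, hφclose α x (hR1 α hαR).le hx (norm_sub_rev α x ▸ hlt) hαφ⟩
    -- In x^s + b = ∏ (x - α') every factor with α' ≠ α has absolute value 1.
    rw [← prod_sub_roots_X_pow_add s hs0 (b : E) x hb0, ← hR, norm_prod,
      Finset.prod_eq_single_of_mem α hαR]
    intro α' hα' hne
    rw [show x - α' = (x - α) - (α' - α) by ring, norm_sub_eq_right_of_lt]
    · exact hdist α' hα' α hαR hne
    · rw [hdist α' hα' α hαR hne]; exact hlt

end UnitBall

/-! ### The polygon of the trinomial at a root of X^s + b -/

section Trinomial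

variable {E : Type*} [NormedField E]

theorem coeff_taylor_trinomial (α a b : E) (n m i : ℕ) :
    (taylor α (X ^ n + C a * X ^ m + C b)).coeff i =
      α ^ (n - i) * n.choose i + a * (α ^ (m - i) * m.choose i) + if i = 0 then b else 0 := by
  simp only [map_add, taylor_mul, taylor_pow, taylor_X, taylor_C, coeff_add, coeff_C_mul,
    coeff_X_add_C_pow, coeff_C]

variable [IsUltrametricDist E] {p : ℕ} [hp : Fact p.Prime]

/-- The Newton polygon of a trinomial `X ^ n + a X ^ m + b`, `p ∣ a`, at a point `α` with `|α| = 1`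
where its value has the valuation `k`. -/
theorem hasPrimePowPolygon_taylor_trinomial (hE : ‖(p : E)‖ = (p : ℝ)⁻¹) {α : E} (hα : ‖α‖ = 1)
    {a b : ℤ} {n m s r k : ℕ} (hn : n = s * p ^ r) (hs : ¬ p ∣ s)
    (ha : (p : ℤ) ^ k ∣ a) (h0 : ‖α ^ n + a * α ^ m + b‖ ≤ ((p : ℝ)⁻¹) ^ k)
    (h0' : k ≤ r → ‖α ^ n + a * α ^ m + b‖ = ((p : ℝ)⁻¹) ^ k) :
    HasPrimePowPolygon p r k (taylor α (X ^ n + C (a : E) * X ^ m + C (b : E))) := by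
  have hp0 : 0 < (p : ℝ)⁻¹ := by have := hp.out.pos; positivity
  have hp1 : (p : ℝ)⁻¹ < 1 := inv_lt_one_of_one_lt₀ (by exact_mod_cast hp.out.one_lt)
  have hanti := pow_right_strictAnti₀ hp0 hp1
  have hnat : ∀ q : ℕ, ‖(q : E)‖ ≤ 1 := fun q => IsUltrametricDist.norm_natCast_le_one E q
  have hchoose : ∀ q j : ℕ, ‖α ^ j * (q : E)‖ = ‖(q : E)‖ := by
    intro q j; rw [norm_mul, norm_pow, hα, one_pow, one_mul]
  have hmid : ∀ i, ‖(a : E) * (α ^ (m - i) * m.choose i)‖ ≤ ((p : ℝ)⁻¹) ^ k := by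
    intro i
    rw [norm_mul, hchoose]
    exact (mul_le_of_le_one_right (norm_nonneg _) (hnat _)).trans (norm_intCast_le_of_dvd hE ha)
  have hcoeff : ∀ i, 1 ≤ i → (taylor α (X ^ n + C (a : E) * X ^ m + C (b : E))).coeff i =
      α ^ (n - i) * n.choose i + a * (α ^ (m - i) * m.choose i) := by
    intro i hi
    rw [coeff_taylor_trinomial, if_neg (by omega), add_zero]
  have hcoeff0 : (taylor α (X ^ n + C (a : E) * X ^ m + C (b : E))).coeff 0 =
      α ^ n + a * α ^ m + b := by
    rw [coeff_taylor_trinomial]; simp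
  refine ⟨fun i => ?_, fun i u w hi hiu hwu hwk => ?_, fun j hj hjk => ?_, ?_, ?_⟩
  · rcases Nat.eq_zero_or_pos i with rfl | hi
    · rw [hcoeff0]
      exact h0.trans (pow_le_one₀ hp0.le hp1.le)
    · rw [hcoeff i hi]
      refine (IsUltrametricDist.norm_add_le_max _ _).trans (max_le ?_ ?_)
      · rw [hchoose]; exact hnat _
      · exact (hmid i).trans (pow_le_one₀ hp0.le hp1.le)
  · rw [hcoeff i hi]
    refine (IsUltrametricDist.norm_add_le_max _ _).trans (max_le ?_ ?_)
    · rw [hchoose]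
      have h1 := pow_dvd_choose_mul_pow (s := s) hp.out hi hiu hwu
      rw [← hn] at h1
      have := norm_intCast_le_of_dvd hE (z := n.choose i) (k := w) (by exact_mod_cast h1)
      simpa using this
    · exact (hmid i).trans (hanti.antitone hwk)
  · rw [hcoeff _ (Nat.one_le_pow _ _ hp.out.pos)]
    obtain ⟨q, hq, hqe⟩ := choose_mul_pow_prime_pow hp.out hs hj
    rw [← hn] at hqe
    have h1 : ‖α ^ (n - p ^ j) * (n.choose (p ^ j) : E)‖ = ((p : ℝ)⁻¹) ^ (r - j) := by
      rw [hchoose, hqe]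
      have := norm_intCast_pow_mul hE (z := q) (by exact_mod_cast hq) (r - j)
      simpa using this
    -- Where r - j < k, the binomial term strictly exceeds the term coming from a, whose valuation
    -- is at least k.
    have h2 : ‖(a : E) * (α ^ (m - p ^ j) * m.choose (p ^ j))‖ <
        ‖α ^ (n - p ^ j) * (n.choose (p ^ j) : E)‖ := by
      rw [h1]
      exact (hmid _).trans_lt (hanti hjk)
    rw [IsUltrametricDist.norm_add_eq_max_of_norm_ne_norm h2.ne', max_eq_left h2.le, h1]
  · rw [hcoeff0]; exact h0
  · intro hk; rw [hcoeff0]; exact h0' hk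

end Trinomial

/-! ### Embeddings and the roots of the defining polynomial -/

section Embeddings

variable {K : Type*} [Field K] [NumberField K] {E : Type*} [Field E] [Algebra ℚ E] [IsAlgClosed E]

theorem map_eq_prod_embeddings {θ : K} (hK : IntermediateField.adjoin ℚ {θ} = ⊤) {f : ℤ[X]}
    (hf : f.Monic) (hirr : Irreducible f) (hθ : aeval θ f = 0) :
    f.map (Int.castRingHom E) = ∏ σ : K →ₐ[ℚ] E, (X - C (σ θ)) := by
  classical
  have hint : IsIntegral ℚ θ := Algebra.IsIntegral.isIntegral θ
  have hmin : f.map (Int.castRingHom ℚ) = minpoly ℚ θ := by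
    refine minpoly.eq_of_irreducible_of_monic ?_ ?_ (hf.map _)
    · exact (hf.irreducible_iff_irreducible_map_fraction_map (K := ℚ)).1 hirr
    · rw [← algebraMap_int_eq, aeval_map_algebraMap, hθ]
  have hmap : f.map (Int.castRingHom E) = (minpoly ℚ θ).map (algebraMap ℚ E) := by
    rw [← hmin, map_map]
    congr 1
    exact RingHom.ext_int _ _
  have htop : Algebra.adjoin ℚ {θ} = ⊤ := by
    rw [← IntermediateField.adjoin_simple_toSubalgebra_of_isAlgebraic hint.isAlgebraic, hK,
      IntermediateField.top_toSubalgebra]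
  have hinj : Function.Injective fun σ : K →ₐ[ℚ] E => σ θ := fun σ τ h =>
    AlgHom.ext_of_adjoin_eq_top htop (by simpa [Set.EqOn] using h)
  have hsep : ((minpoly ℚ θ).map (algebraMap ℚ E)).Separable :=
    (minpoly.irreducible hint).separable.map
  have hroots : ((minpoly ℚ θ).map (algebraMap ℚ E)).roots =
      (Finset.univ.image fun σ : K →ₐ[ℚ] E => σ θ).val := by
    rw [← Multiset.dedup_eq_self.2 (nodup_roots hsep), ← Multiset.toFinset_val]
    congr 1
    ext x
    have h := Set.ext_iff.1 ((Algebra.IsAlgebraic.of_finite ℚ K).range_eval_eq_rootSet_minpoly E θ) x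
    rw [Finset.mem_image]
    simp only [Finset.mem_univ, true_and]
    rw [rootSet, Set.mem_range] at h
    rw [h]
    simp [aroots]
  rw [hmap, (IsAlgClosed.splits _).eq_prod_roots_of_monic ((minpoly.monic hint).map _), hroots]
  change ∏ x ∈ Finset.univ.image (fun σ : K →ₐ[ℚ] E => σ θ), (X - C x) = _
  rw [Finset.prod_image fun σ _ τ _ h => hinj h]

end Embeddings

/-! ### Lower bound for the residue degree -/

section ResidueDegree

variable {K : Type*} [Field K] [NumberField K] {p : ℕ} [hp : Fact p.Prime]

/-- The reduction of θ is a root of φ in the residue field, so its minimal polynomial there has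
degree deg φ. -/
theorem natDegree_le_of_aeval_mem {P : Ideal (𝓞 K)} [hP : P.IsPrime] (hpP : (p : 𝓞 K) ∈ P)
    {θ : 𝓞 K} {φ : ℤ[X]} (hφ : φ.Monic) (hirr : Irreducible (φ.map (Int.castRingHom (ZMod p))))
    (hθ : aeval θ φ ∈ P) {f : ℕ} (hf : Ideal.absNorm P = p ^ f) : φ.natDegree ≤ f := by
  have hPbot : P ≠ ⊥ := by
    rintro rfl
    have : (p : 𝓞 K) = 0 := by simpa using hpP
    exact hp.out.ne_zero (by exact_mod_cast this)
  have hPmax : P.IsMaximal := hP.isMaximal hPbot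
  let := Ideal.Quotient.field P
  have hchar : CharP (𝓞 K ⧸ P) p := by
    have h0 : ((p : ℕ) : 𝓞 K ⧸ P) = 0 := by
      rw [← map_natCast (Ideal.Quotient.mk P)]
      exact Ideal.Quotient.eq_zero_iff_mem.2 hpP
    exact (CharP.charP_iff_prime_eq_zero hp.out).2 h0
  let := ZMod.algebra (𝓞 K ⧸ P) p
  have hev : aeval (Ideal.Quotient.mk P θ) (φ.map (Int.castRingHom (ZMod p))) = 0 := by
    rw [← Ideal.Quotient.eq_zero_iff_mem.2 hθ, aeval_def, eval₂_map, aeval_def, hom_eval₂]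
    congr 1
    exact RingHom.ext_int _ _
  have hcard : Nat.card (𝓞 K ⧸ P) = p ^ f := hf
  have : Finite (𝓞 K ⧸ P) := Nat.finite_of_card_ne_zero (by
    rw [hcard]; exact (pow_pos hp.out.pos f).ne')
  have h1 := minpoly.eq_of_irreducible_of_monic hirr hev (hφ.map _)
  have h2 := minpoly.natDegree_le (A := ZMod p) (Ideal.Quotient.mk P θ)
  rw [← h1, hφ.natDegree_map] at h2
  rw [Module.natCard_eq_pow_finrank (K := ZMod p), Nat.card_zmod] at hcard
  rwa [Nat.pow_right_injective hp.out.two_le hcard] at h2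

end ResidueDegree

/-! ### One prime for each irreducible factor and each side -/

section Sides

theorem aeval_algHom_ringOfIntegers {K E : Type*} [Field K]
    [Field E] [Algebra ℚ E] [Algebra ℚ K] (σ : K →ₐ[ℚ] E) (θ : 𝓞 K) (φ : ℤ[X]) :
    aeval (σ θ) φ = σ (aeval θ φ : 𝓞 K) := by
  have h := hom_eval₂ φ (algebraMap ℤ (𝓞 K)) ((σ : K →+* E).comp (algebraMap (𝓞 K) K)) θ
  have h1 : ((σ : K →+* E).comp (algebraMap (𝓞 K) K)).comp (algebraMap ℤ (𝓞 K)) =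
      algebraMap ℤ E := RingHom.ext_int _ _
  rw [h1] at h
  exact h.symm

variable {K : Type*} [Field K] [NumberField K] {E : Type*} [NormedField E] [IsUltrametricDist E]
  [Algebra ℚ E] {p : ℕ} [hp : Fact p.Prime]

variable [IsAlgClosed E] [CharZero E]

/-- Every side of the Newton polygons at the roots of an irreducible factor `φ` of `X ^ s + b`
yields a prime above `p` whose residue degree is the degree of `φ`. -/
theorem exists_place_of_side (hE : ‖(p : E)‖ = (p : ℝ)⁻¹) (hp3 : 3 ≤ p) {θ : 𝓞 K} {F : E[X]}
    (hF : F = ∏ σ : K →ₐ[ℚ] E, (X - C (σ θ))) {s : ℕ} {b : ℤ} (hs : ¬ p ∣ s)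
    (hb : ¬ (p : ℤ) ∣ b) {φ : ℤ[X]} (hφ : φ.Monic) (hd : 0 < φ.natDegree)
    (hirr : Irreducible (φ.map (Int.castRingHom (ZMod p))))
    (hdvd : φ.map (Int.castRingHom (ZMod p)) ∣ X ^ s + C (b : ZMod p)) {r k t : ℕ}
    (hk : k ≤ r + 1) (ht : 1 ≤ t) (htk : t ≤ k)
    (hpoly : ∀ α : E, α ^ s = -b → ‖aeval α φ‖ < 1 → HasPrimePowPolygon p r k (taylor α F)) :
    ∃ σ₀ : K →ₐ[ℚ] E, Ideal.absNorm (placeIdeal σ₀) = p ^ φ.natDegree ∧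
      ∀ σ : K →ₐ[ℚ] E, placeIdeal σ = placeIdeal σ₀ →
        ‖aeval (σ θ) φ‖ < 1 ∧ OnSide p r k t ‖σ θ ^ s + b‖ := by
  classical
  obtain ⟨A, hA, ⟨α₀, hα₀⟩, hAroot, hAnear, hAnorm⟩ := exists_finset_lifted_roots hE hs hb hφ hd hdvd
  set l := sideLength p r k t with hl
  have hl0 : 0 < l := sideLength_pos hp3
  have hcount : ∀ α ∈ A,
      (Finset.univ.filter fun σ : K →ₐ[ℚ] E => OnSide p r k t ‖σ θ - α‖).card = l := by
    intro α hα
    have hprod : taylor α F = (((Finset.univ : Finset (K →ₐ[ℚ] E)).val.map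
        fun σ => σ θ - α).map fun β => X - C β).prod := by
      rw [Multiset.map_map, hF]
      change taylorAlgHom α _ = ∏ σ : K →ₐ[ℚ] E, (X - C (σ θ - α))
      rw [map_prod]
      refine Finset.prod_congr rfl fun σ _ => ?_
      simp
      ring
    have h1 := (hpoly α (hAroot α hα).1 (hAroot α hα).2).countP_onSide hp3 hk hprod ht htk
    rw [Multiset.countP_map] at h1
    exact h1
  set S := Finset.univ.filter fun σ : K →ₐ[ℚ] E =>
    ‖aeval (σ θ) φ‖ < 1 ∧ OnSide p r k t ‖σ θ ^ s + b‖ with hS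
  have hScard : S.card ≤ φ.natDegree * l := by
    have hsub : S ⊆ A.biUnion fun α =>
        Finset.univ.filter fun σ : K →ₐ[ℚ] E => OnSide p r k t ‖σ θ - α‖ := by
      intro σ hσ
      obtain ⟨-, h1, h2⟩ := Finset.mem_filter.1 hσ
      obtain ⟨α, hα, hlt⟩ := hAnear (σ θ) (norm_algHom_le_one σ θ) h1
      rw [(hAnorm α hα (σ θ) (norm_algHom_le_one σ θ) hlt).1] at h2
      exact Finset.mem_biUnion.2 ⟨α, hα, Finset.mem_filter.2 ⟨Finset.mem_univ _, h2⟩⟩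
    refine (Finset.card_le_card hsub).trans (Finset.card_biUnion_le.trans ?_)
    rw [Finset.sum_congr rfl hcount, Finset.sum_const, smul_eq_mul]
    exact Nat.mul_le_mul_right l hA
  obtain ⟨σ₀, hσ₀⟩ : ∃ σ₀ : K →ₐ[ℚ] E, σ₀ ∈ S := by
    obtain ⟨σ, hσ⟩ := Finset.card_pos.1 (hcount α₀ hα₀ ▸ hl0)
    have h1 := (Finset.mem_filter.1 hσ).2
    obtain ⟨h2, h3⟩ := hAnorm α₀ hα₀ (σ θ) (norm_algHom_le_one σ θ)
      (h1.lt_one hp3 (norm_nonneg _))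
    exact ⟨σ, Finset.mem_filter.2 ⟨Finset.mem_univ _, h3, h2 ▸ h1⟩⟩
  obtain ⟨hσφ, hσside⟩ := (Finset.mem_filter.1 hσ₀).2
  have hpP := natCast_mem_placeIdeal hE σ₀
  obtain ⟨π, e, f, hf, hf0, hπ, hval, hcard⟩ := exists_local_data hE hpP
  have hpinv0 : 0 < (p : ℝ)⁻¹ := by have := hp.out.pos; positivity
  have hpinv1 : (p : ℝ)⁻¹ < 1 := inv_lt_one_of_one_lt₀ (by exact_mod_cast hp.out.one_lt)
  have he0 : e ≠ 0 := by
    rintro rfl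
    have := hπ σ₀ rfl
    rw [pow_zero] at this
    exact hpinv1.ne this.symm
  -- The element θ^s + b of K replaces θ - α, since α need not come from K: near α both have the
  -- same absolute value. This makes the side depend only on the prime, not on the embedding.
  have hψ : ∀ σ : K →ₐ[ℚ] E, σ θ ^ s + b = σ ((θ ^ s + (b : 𝓞 K) : 𝓞 K) : K) := by
    intro σ; simp
  have hclass : ∀ σ : K →ₐ[ℚ] E, placeIdeal σ = placeIdeal σ₀ → σ ∈ S := by
    intro σ hσ
    have h1 : ‖aeval (σ θ) φ‖ < 1 := by
      rw [aeval_algHom_ringOfIntegers, ← mem_placeIdeal, hσ, mem_placeIdeal,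
        ← aeval_algHom_ringOfIntegers]
      exact hσφ
    have h2 : ‖σ θ ^ s + b‖ = ‖σ₀ θ ^ s + b‖ := by
      rw [hψ, hψ]
      by_cases h0 : θ ^ s + (b : 𝓞 K) = 0
      · rw [h0]; simp
      · obtain ⟨m, hm⟩ := hval _ h0
        rw [hm σ hσ, hm σ₀ rfl,
          (pow_left_inj₀ (norm_nonneg _) (norm_nonneg _) he0).1 ((hπ σ hσ).trans (hπ σ₀ rfl).symm)]
    exact Finset.mem_filter.2 ⟨Finset.mem_univ _, h1, h2 ▸ hσside⟩
  have hle : e * f ≤ φ.natDegree * l := by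
    rw [← hcard]
    exact (Finset.card_le_card fun σ hσ => hclass σ (Finset.mem_filter.1 hσ).2).trans hScard
  have hel : l ≤ e := by
    by_cases htr : t = r + 1
    · have : l = 1 := by
        rw [hl, sideLength, if_neg (by omega), show r + 1 - k = 0 by omega, pow_zero]
      omega
    · rw [OnSide, if_neg htr, ← hl] at hσside
      have h0 : θ ^ s + (b : 𝓞 K) ≠ 0 := by
        intro h0
        rw [hψ, h0] at hσside
        simp [hl0.ne'] at hσside
        exact hp.out.ne_zero (by exact_mod_cast hσside.symm)
      obtain ⟨m, hm⟩ := hval _ h0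
      -- If θ^s + b has valuation m at P, the side condition reads |π|^(m l) = |π|^e; thus l divides
      -- e.
      rw [hψ, hm σ₀ rfl, ← pow_mul, ← hπ σ₀ rfl] at hσside
      have hπ0 : 0 < ‖σ₀ π‖ := by
        rcases (norm_nonneg (σ₀ π)).eq_or_lt with h | h
        · have := hπ σ₀ rfl
          rw [← h, zero_pow he0] at this
          exact absurd this hpinv0.ne
        · exact h
      have hπ1 : ‖σ₀ π‖ < 1 :=
        (pow_lt_one_iff_of_nonneg hπ0.le he0).1 ((hπ σ₀ rfl).symm ▸ hpinv1)
      have h1 := (pow_right_strictAnti₀ hπ0 hπ1).injective hσside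
      exact Nat.le_of_dvd (Nat.pos_of_ne_zero he0) ⟨m, by rw [← h1, mul_comm]⟩
  have hfd : f ≤ φ.natDegree := by
    have h1 : l * f ≤ l * φ.natDegree := by
      rw [mul_comm l φ.natDegree]
      exact (Nat.mul_le_mul_right f hel).trans hle
    exact Nat.le_of_mul_le_mul_left h1 hl0
  have hdf : φ.natDegree ≤ f := by
    refine natDegree_le_of_aeval_mem hpP hφ hirr (θ := θ) ?_ hf
    rw [mem_placeIdeal, ← aeval_algHom_ringOfIntegers]
    exact hσφ
  exact ⟨σ₀, by rw [hf, le_antisymm hfd hdf], fun σ hσ => (Finset.mem_filter.1 (hclass σ hσ)).2⟩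

/-- A common index divisor criterion for trinomials: `p` divides the index of the field as soon as
the sides of the Newton polygons yield too many primes of residue degree `d`. -/
theorem dvd_elementIndex_of_numIrred_lt (hE : ‖(p : E)‖ = (p : ℝ)⁻¹) (hp3 : 3 ≤ p) {θ : 𝓞 K}
    {F : E[X]} (hF : F = ∏ σ : K →ₐ[ℚ] E, (X - C (σ θ))) {s : ℕ} {b : ℤ} (hs : ¬ p ∣ s)
    (hb : ¬ (p : ℤ) ∣ b) {r k d : ℕ} (hk : k ≤ r + 1) (hd : 0 < d) (G : Set (ZMod p)[X])
    (hG : ∀ g ∈ G, g.Monic ∧ Irreducible g ∧ g.natDegree = d ∧ g ∣ X ^ s + C (b : ZMod p))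
    (hpoly : ∀ φ : ℤ[X], φ.map (Int.castRingHom (ZMod p)) ∈ G → ∀ α : E, α ^ s = -b →
      ‖aeval α φ‖ < 1 → HasPrimePowPolygon p r k (taylor α F))
    (hlt : numIrred p d < k * G.ncard) (η : 𝓞 K) : p ∣ elementIndex η := by
  by_contra hη
  obtain ⟨hfin, hle⟩ := ncard_primes_le_numIrred hη d
  have hlift : ∀ g ∈ G, ∃ φ : ℤ[X], φ.map (Int.castRingHom (ZMod p)) = g ∧ φ.Monic ∧
      φ.natDegree = d := by
    intro g hg
    obtain ⟨h1, -, h3, -⟩ := hG g hg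
    obtain ⟨φ, h4, h5, h6⟩ := lifts_and_natDegree_eq_and_monic
      (map_surjective _ (ZMod.ringHom_surjective (Int.castRingHom (ZMod p))) g) h1
    exact ⟨φ, h4, h6, h5.trans h3⟩
  choose! φ hφmap hφmonic hφdeg using hlift
  have : Nonempty (K →ₐ[ℚ] E) := ⟨IsAlgClosed.lift⟩
  have hex : ∀ x ∈ G ×ˢ Set.Icc 1 k, ∃ σ₀ : K →ₐ[ℚ] E,
      Ideal.absNorm (placeIdeal σ₀) = p ^ d ∧
      ∀ σ : K →ₐ[ℚ] E, placeIdeal σ = placeIdeal σ₀ →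
        ‖aeval (σ θ) (φ x.1)‖ < 1 ∧ OnSide p r k x.2 ‖σ θ ^ s + b‖ := by
    rintro ⟨g, t⟩ ⟨hg, ht⟩
    simp only at hg ht
    obtain ⟨-, h2, -, h4⟩ := hG g hg
    have h5 := exists_place_of_side hE hp3 hF hs hb (hφmonic g hg) (by rw [hφdeg g hg]; exact hd)
      (by rwa [hφmap g hg]) (by rwa [hφmap g hg]) hk ht.1 ht.2
      (hpoly (φ g) (by rwa [hφmap g hg]))
    rwa [hφdeg g hg] at h5
  choose! σ hσnorm hσ using hex
  have hinj : Set.InjOn (fun x => placeIdeal (σ x)) (G ×ˢ Set.Icc 1 k) := by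
    rintro ⟨g, t⟩ hx ⟨g', t'⟩ hx' hP
    have h1 := hσ _ hx _ rfl
    have h2 := hσ _ hx' _ hP
    simp only at h1 h2
    -- One embedding satisfies the conditions of both pairs: its absolute value determines the side,
    -- and the reduction of θ determines the factor.
    have ht : t = t' := OnSide.unique hp.out hp3 hx.2.2 hk hx'.2.2 (norm_nonneg _) h1.2 h2.2
    have hgg : g = g' := by
      by_contra hne
      have h3 := norm_aeval_eq_one_of_not_dvd hE (norm_algHom_le_one (σ (g, t)) θ)
        (h₁ := φ g) (h₂ := φ g') (by rw [hφmap g hx.1]; exact (hG g hx.1).2.1) (by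
          rw [hφmap g hx.1, hφmap g' hx'.1]
          intro hdvd
          exact hne (eq_of_monic_of_associated (hG g hx.1).1 (hG g' hx'.1).1
            ((hG g hx.1).2.1.associated_of_dvd (hG g' hx'.1).2.1 hdvd))) h1.1
      exact h2.1.ne h3
    rw [ht, hgg]
  have hcard := Set.ncard_le_ncard_of_injOn (fun x => placeIdeal (σ x))
    (s := G ×ˢ Set.Icc 1 k)
    (t := {P : Ideal (𝓞 K) | P.IsPrime ∧ (p : 𝓞 K) ∈ P ∧ Ideal.absNorm P = p ^ d}) (fun x hx => ⟨inferInstance, natCast_mem_placeIdeal hE _, hσnorm x hx⟩)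
    hinj hfin
  rw [Set.ncard_prod, ← Nat.card_coe_set_eq (Set.Icc 1 k), Nat.card_eq_fintype_card,
    Fintype.card_ofFinset, Nat.card_Icc, Nat.add_sub_cancel, mul_comm] at hcard
  omega

end Sides

/-! ### The valuation of b + (-b)^(p^r) -/

section Arithmetic

variable {p : ℕ} [hp : Fact p.Prime]

/-- As p^r is odd, the left side is -b (b^(p^r-1) - 1). Writing p^r - 1 = (p - 1) q, the cofactor of
b^(p-1) - 1 is a geometric sum congruent to q modulo p, and p ∤ q. So ν is also the valuation of the
left side. -/
theorem exists_add_neg_pow_eq_mul (hp2 : p ≠ 2) {b : ℤ} (hb : ¬ (p : ℤ) ∣ b) {r : ℕ} (hr : 1 ≤ r) :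
    ∃ u : ℤ, ¬ (p : ℤ) ∣ u ∧ b + (-b) ^ p ^ r = (b ^ (p - 1) - 1) * u := by
  have hpi := Nat.prime_iff_prime_int.1 hp.out
  obtain ⟨q, hq⟩ : p - 1 ∣ p ^ r - 1 := by simpa using Nat.sub_dvd_pow_sub_pow p 1 r
  have hpr : 1 ≤ p ^ r := Nat.one_le_pow _ _ hp.out.pos
  have hqp : ¬ p ∣ q := by
    intro h
    have h1 : p ∣ p ^ r - 1 := hq ▸ h.mul_left _
    have h2 : p ∣ p ^ r := dvd_pow_self p (by omega)
    have h3 := (Nat.dvd_sub_iff_right hpr h2).1 h1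
    exact hp.out.one_lt.ne' (Nat.dvd_one.1 h3)
  set x := b ^ (p - 1) with hx
  have hx1 : (p : ℤ) ∣ x - 1 := by
    have h := ZMod.pow_card_sub_one_eq_one (p := p) (a := (b : ZMod p)) (by
      rwa [Ne, ZMod.intCast_zmod_eq_zero_iff_dvd])
    rw [← ZMod.intCast_zmod_eq_zero_iff_dvd, hx]
    push_cast
    rw [h, sub_self]
  have hS : ¬ (p : ℤ) ∣ ∑ i ∈ Finset.range q, x ^ i := by
    intro h
    have hxz : (x : ZMod p) = 1 := by
      have := (ZMod.intCast_zmod_eq_zero_iff_dvd (x - 1) p).2 hx1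
      push_cast at this
      exact sub_eq_zero.1 this
    have h1 := (ZMod.intCast_zmod_eq_zero_iff_dvd _ p).2 h
    push_cast at h1
    rw [hxz] at h1
    simp only [one_pow, Finset.sum_const, Finset.card_range, nsmul_eq_mul, mul_one] at h1
    exact hqp ((ZMod.natCast_eq_zero_iff q p).1 h1)
  refine ⟨-b * ∑ i ∈ Finset.range q, x ^ i, ?_, ?_⟩
  · intro h
    rcases hpi.dvd_or_dvd h with h | h
    · exact hb ((dvd_neg).1 h)
    · exact hS h
  · have hodd : Odd (p ^ r) := (hp.out.odd_of_ne_two hp2).pow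
    have h1 : b ^ p ^ r = b * x ^ q := by
      rw [hx, ← pow_mul, ← hq, ← pow_succ']
      congr 1
      omega
    rw [hodd.neg_pow, h1]
    have h2 := geom_sum_mul x q
    linear_combination (-b) * h2.symm

/-- The cast from ℚ to `ZMod p` respects a fraction only when its denominator is prime to p, so p^k
is cancelled first. -/
theorem ratCast_div_eq {k : ℕ} {y z : ℤ} (hz : ¬ (p : ℤ) ∣ z) :
    (((((p : ℤ) ^ k * y : ℤ) : ℚ) / (((p : ℤ) ^ k * z : ℤ) : ℚ) : ℚ) : ZMod p) = y / z := by
  have hp0 : (p : ℚ) ^ k ≠ 0 := pow_ne_zero _ (by exact_mod_cast hp.out.ne_zero)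
  have hz0 : (z : ZMod p) ≠ 0 := by rwa [Ne, ZMod.intCast_zmod_eq_zero_iff_dvd]
  push_cast
  rw [mul_div_mul_left _ _ hp0, ← Rat.divInt_eq_div, Rat.cast_divInt_of_ne_zero _ hz0]

omit hp in
theorem exists_eq_pow_mul_of_emultiplicity_eq {k : ℕ} {z : ℤ}
    (h : emultiplicity (p : ℤ) z = k) : ∃ y, ¬ (p : ℤ) ∣ y ∧ z = (p : ℤ) ^ k * y := by
  obtain ⟨⟨y, hy⟩, h2⟩ := emultiplicity_eq_coe.1 h
  refine ⟨y, fun hd => h2 ?_, hy⟩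
  rw [hy, pow_succ]
  exact mul_dvd_mul_left _ hd

variable {E : Type*} [NormedField E] [IsUltrametricDist E]

theorem norm_add_eq_of_dvd_of_eq (hE : ‖(p : E)‖ = (p : ℝ)⁻¹) {k : ℕ} {y z : ℤ} {x : E}
    (hx : ‖x‖ = ((p : ℝ)⁻¹) ^ k) (hz : z = (p : ℤ) ^ (k + 1) * y) :
    ‖x + z‖ = ((p : ℝ)⁻¹) ^ k := by
  have hp0 : 0 < (p : ℝ)⁻¹ := by have := hp.out.pos; positivity
  have hp1 : (p : ℝ)⁻¹ < 1 := inv_lt_one_of_one_lt₀ (by exact_mod_cast hp.out.one_lt)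
  have h1 : ‖(z : E)‖ < ‖x‖ := by
    rw [hx]
    exact (norm_intCast_le_of_dvd hE ⟨y, hz⟩).trans_lt
      (pow_right_strictAnti₀ hp0 hp1 (Nat.lt_succ_self k))
  rw [IsUltrametricDist.norm_add_eq_max_of_norm_ne_norm h1.ne', max_eq_left h1.le, hx]

end Arithmetic

/-! ### The four cases -/

theorem theorem2p1 {K : Type*} [Field K] [NumberField K]
    (a b : ℤ) (n m : ℕ) (hm : 0 < m) (hmn : m < n)
    (hirr : Irreducible (X ^ n + C a * X ^ m + C b : ℤ[X]))
    (θ : K) (hθ : aeval θ (X ^ n + C a * X ^ m + C b : ℤ[X]) = 0)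
    (hK : IntermediateField.adjoin ℚ {θ} = ⊤)
    (p : ℕ) [Fact p.Prime] (hp2 : p ≠ 2)
    (hpa : (p : ℤ) ∣ a) (hpb : ¬ (p : ℤ) ∣ b) (hpn : p ∣ n)
    (s r : ℕ) (hn : n = s * p ^ r) (hs : ¬ p ∣ s)
    (μ ν : ℕ∞) (hμ : μ = emultiplicity (p : ℤ) a)
    (hν : ν = emultiplicity (p : ℤ) (b ^ (p - 1) - 1))
    (d : ℕ) (hd : 0 < d)
    (h : (μ < min ν (r + 1) ∧
            (numIrred p d : ℕ∞) < μ * numIrredFactors p d s (b : ZMod p)) ∨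
         (ν < min μ (r + 1) ∧
            (numIrred p d : ℕ∞) < ν * numIrredFactors p d s (b : ZMod p)) ∨
         (μ = ν ∧ ν ≤ r ∧
            (numIrred p d : ℕ∞) < μ * numIrredFactorsNotDvd p d s (b : ZMod p) m
              ((((b + (-b) ^ p ^ r : ℤ) : ℚ) / (a : ℚ) : ℚ) : ZMod p)) ∨
         ((r : ℕ∞) + 1 ≤ min ν μ ∧
            numIrred p d < (r + 1) * numIrredFactors p d s (b : ZMod p))) :
    p ∣ NumberField.fieldIndex K ∧ ¬ NumberField.IsMonogenicField K := by
  have hp : p.Prime := Fact.out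
  suffices hdvd : p ∣ NumberField.fieldIndex K from
    ⟨hdvd, not_isMonogenicField_of_dvd_fieldIndex hdvd⟩
  rw [NumberField.dvd_fieldIndex_iff]
  rintro η -
  have hp3 : 3 ≤ p := by have := hp.two_le; omega
  have hs0 : s ≠ 0 := by rintro rfl; simp at hs
  have hr : 1 ≤ r := by
    by_contra hr
    rw [show r = 0 by omega, pow_zero, mul_one] at hn
    exact hs (hn ▸ hpn)
  have hE : ‖(p : PadicAlgCl p)‖ = (p : ℝ)⁻¹ := by
    have := PadicAlgCl.norm_extends p (p : ℚ_[p])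
    simpa using this
  have hmonic : (X ^ n + C a * X ^ m + C b : ℤ[X]).Monic := by
    rw [add_assoc]
    exact monic_X_pow_add ((degree_add_le _ _).trans_lt (max_lt
      ((degree_C_mul_X_pow_le m a).trans_lt (by exact_mod_cast hmn))
      (degree_C_le.trans_lt (by exact_mod_cast hm.trans hmn))))
  obtain ⟨ϑ, rfl⟩ : ∃ ϑ : 𝓞 K, (ϑ : K) = θ := ⟨⟨θ, _, hmonic, hθ⟩, rfl⟩
  have hF : (X ^ n + C (a : PadicAlgCl p) * X ^ m + C (b : PadicAlgCl p)) =
      ∏ σ : K →ₐ[ℚ] PadicAlgCl p, (X - C (σ ϑ)) := by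
    rw [← map_eq_prod_embeddings hK hmonic hirr hθ]
    simp
  obtain ⟨u, hu, hB⟩ := exists_add_neg_pow_eq_mul hp2 hpb hr
  have hBν : ν = emultiplicity (p : ℤ) (b + (-b) ^ p ^ r) := by
    rw [hB, emultiplicity_mul (Nat.prime_iff_prime_int.1 hp),
      emultiplicity_eq_zero.2 hu, add_zero, hν]
  have hval : ∀ α : PadicAlgCl p, α ^ s = -b →
      α ^ n + a * α ^ m + b = a * α ^ m + ((b + (-b) ^ p ^ r : ℤ) : PadicAlgCl p) := by
    intro α hα
    rw [hn, pow_mul, hα]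
    push_cast
    ring
  have hα1 : ∀ α : PadicAlgCl p, α ^ s = -b → ‖α‖ = 1 := fun α hα =>
    norm_eq_one_of_pow_eq_neg hE hs0 hpb hα
  -- The cases differ only in the number k of sides and in the set G of admissible factors; what
  -- remains in each is the valuation of F(α).
  have key : ∀ (k : ℕ), k ≤ r + 1 → (p : ℤ) ^ k ∣ a → ∀ G : Set (ZMod p)[X],
      (∀ g ∈ G, g.Monic ∧ Irreducible g ∧ g.natDegree = d ∧ g ∣ X ^ s + C (b : ZMod p)) →
      (∀ φ : ℤ[X], φ.map (Int.castRingHom (ZMod p)) ∈ G → ∀ α : PadicAlgCl p, α ^ s = -b →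
        ‖aeval α φ‖ < 1 → ‖α ^ n + a * α ^ m + b‖ ≤ ((p : ℝ)⁻¹) ^ k ∧
          (k ≤ r → ‖α ^ n + a * α ^ m + b‖ = ((p : ℝ)⁻¹) ^ k)) →
      numIrred p d < k * G.ncard → p ∣ NumberField.elementIndex η := by
    intro k hk hak G hG hnorm hlt
    refine dvd_elementIndex_of_numIrred_lt hE hp3 hF hs hpb hk hd G hG ?_ hlt η
    intro φ hφ α hα hφα
    obtain ⟨h1, h2⟩ := hnorm φ hφ α hα hφα
    exact hasPrimePowPolygon_taylor_trinomial hE (hα1 α hα) hn hs hak h1 h2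
  have hGall : ∀ g ∈ {g : (ZMod p)[X] | g.Monic ∧ Irreducible g ∧ g.natDegree = d ∧
      g ∣ X ^ s + C (b : ZMod p)}, g.Monic ∧ Irreducible g ∧ g.natDegree = d ∧
      g ∣ X ^ s + C (b : ZMod p) := fun g hg => hg
  have hmulnorm : ∀ {k : ℕ} {y : ℤ} {α : PadicAlgCl p}, ¬ (p : ℤ) ∣ y → a = (p : ℤ) ^ k * y →
      ‖α‖ = 1 → ‖(a : PadicAlgCl p) * α ^ m‖ = ((p : ℝ)⁻¹) ^ k := by
    intro k y α hy hay hα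
    rw [norm_mul, norm_pow, hα, one_pow, mul_one, hay]
    exact norm_intCast_pow_mul hE hy k
  rcases h with ⟨h1, h2⟩ | ⟨h1, h2⟩ | ⟨h1, h2, h3⟩ | ⟨h1, h2⟩
  · obtain ⟨h3, h4⟩ := lt_min_iff.1 h1
    lift μ to ℕ using h3.ne_top with k
    have hkr : k < r + 1 := by exact_mod_cast h4
    obtain ⟨y, hy, hay⟩ := exists_eq_pow_mul_of_emultiplicity_eq hμ.symm
    obtain ⟨z, hz⟩ : (p : ℤ) ^ (k + 1) ∣ b + (-b) ^ p ^ r :=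
      pow_dvd_of_le_emultiplicity (by
        rw [← hBν]; exact_mod_cast Order.add_one_le_of_lt h3)
    refine key k hkr.le ⟨y, hay⟩ _ hGall ?_ (by exact_mod_cast h2)
    intro φ _ α hα _
    have := norm_add_eq_of_dvd_of_eq hE (hmulnorm hy hay (hα1 α hα)) hz
    rw [hval α hα]
    exact ⟨this.le, fun _ => this⟩
  · obtain ⟨h3, h4⟩ := lt_min_iff.1 h1
    lift ν to ℕ using h3.ne_top with k
    have hkr : k < r + 1 := by exact_mod_cast h4
    obtain ⟨y, hy, hby⟩ := exists_eq_pow_mul_of_emultiplicity_eq hBν.symm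
    obtain ⟨z, hz⟩ : (p : ℤ) ^ (k + 1) ∣ a :=
      pow_dvd_of_le_emultiplicity (by
        rw [← hμ]; exact_mod_cast Order.add_one_le_of_lt h3)
    refine key k hkr.le ((pow_dvd_pow _ (Nat.le_succ k)).trans ⟨z, hz⟩) _ hGall ?_
      (by exact_mod_cast h2)
    intro φ _ α hα _
    have hlt : ‖(a : PadicAlgCl p) * α ^ m‖ <
        ‖((b + (-b) ^ p ^ r : ℤ) : PadicAlgCl p)‖ := by
      rw [hby, norm_intCast_pow_mul hE hy, norm_mul, norm_pow, hα1 α hα, one_pow, mul_one]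
      refine (norm_intCast_le_of_dvd hE ⟨z, hz⟩).trans_lt ?_
      exact pow_lt_pow_right_of_lt_one₀ (by have := hp.pos; positivity)
        (inv_lt_one_of_one_lt₀ (by exact_mod_cast hp.one_lt)) (Nat.lt_succ_self k)
    have : ‖α ^ n + a * α ^ m + b‖ = ((p : ℝ)⁻¹) ^ k := by
      rw [hval α hα, IsUltrametricDist.norm_add_eq_max_of_norm_ne_norm hlt.ne,
        max_eq_right hlt.le, hby, norm_intCast_pow_mul hE hy]
    exact ⟨this.le, fun _ => this⟩
  · have hfin : ν ≠ ⊤ := (h2.trans_lt (ENat.natCast_lt_top r)).ne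
    lift ν to ℕ using hfin with k
    subst h1
    have hkr : k ≤ r := by exact_mod_cast h2
    obtain ⟨y, hy, hay⟩ := exists_eq_pow_mul_of_emultiplicity_eq hμ.symm
    obtain ⟨z, hz, hbz⟩ := exists_eq_pow_mul_of_emultiplicity_eq hBν.symm
    have hy0 : (y : ZMod p) ≠ 0 := by rwa [Ne, ZMod.intCast_zmod_eq_zero_iff_dvd]
    refine key k (by omega) ⟨y, hay⟩ {g : (ZMod p)[X] | g.Monic ∧ Irreducible g ∧
      g.natDegree = d ∧ g ∣ X ^ s + C (b : ZMod p) ∧ ¬ g ∣ X ^ m +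
        C ((((b + (-b) ^ p ^ r : ℤ) : ℚ) / (a : ℚ) : ℚ) : ZMod p)} (fun g hg => ⟨hg.1, hg.2.1, hg.2.2.1, hg.2.2.2.1⟩) ?_
      (by exact_mod_cast h3)
    rintro φ ⟨-, hφirr, -, -, hφm⟩ α hα hφα
    -- With a = p^k y and b + (-b)^(p^r) = p^k z, one has F(α) = p^k (y α^m + z). The second factor
    -- is a unit because the reduction of φ does not divide x^m + z/y.
    have hone := norm_aeval_eq_one_of_not_dvd hE (hα1 α hα).le (h₂ := C y * X ^ m + C z) hφirr
      (fun hdvd => hφm (by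
        have h4 := hdvd.mul_left (C ((y : ZMod p)⁻¹))
        have h5 : C ((y : ZMod p)⁻¹) * (C y * X ^ m + C z : ℤ[X]).map (Int.castRingHom (ZMod p)) =
            X ^ m + C ((z : ZMod p) / y) := by
          rw [Polynomial.map_add, Polynomial.map_mul, map_C, map_C, Polynomial.map_pow, map_X,
            mul_add, ← mul_assoc, ← C_mul, ← C_mul, Int.coe_castRingHom, inv_mul_cancel₀ hy0, C_1,
            one_mul, div_eq_inv_mul]
        rw [h5] at h4
        rwa [hbz, hay, ratCast_div_eq hy])) hφα
    have : ‖α ^ n + a * α ^ m + b‖ = ((p : ℝ)⁻¹) ^ k := by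
      have h6 : α ^ n + a * α ^ m + b = (p : PadicAlgCl p) ^ k *
          (y * α ^ m + z) := by
        rw [hval α hα, hbz, hay]
        push_cast
        ring
      have h7 : ‖(y * α ^ m + z : PadicAlgCl p)‖ = 1 := by simpa using hone
      rw [h6, norm_mul, h7, mul_one, norm_pow, hE]
    exact ⟨this.le, fun _ => this⟩
  · obtain ⟨h3, h4⟩ := le_min_iff.1 h1
    have ha : (p : ℤ) ^ (r + 1) ∣ a := pow_dvd_of_le_emultiplicity (by
      rw [← hμ]; exact_mod_cast h4)
    have hb : (p : ℤ) ^ (r + 1) ∣ b + (-b) ^ p ^ r := pow_dvd_of_le_emultiplicity (by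
      rw [← hBν]; exact_mod_cast h3)
    refine key (r + 1) le_rfl ha _ hGall ?_ h2
    intro φ _ α hα _
    -- For k = r + 1 no exact valuation is required; F(α) may even vanish.
    refine ⟨?_, fun h => by omega⟩
    rw [hval α hα]
    refine (IsUltrametricDist.norm_add_le_max _ _).trans (max_le ?_ (norm_intCast_le_of_dvd hE hb))
    rw [norm_mul, norm_pow, hα1 α hα, one_pow, mul_one]
    exact norm_intCast_le_of_dvd hE ha
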